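/- Let $(V,\gamma)$ be a pseudo-Euclidean vector space, i.e. a finite-dimensional real vector space with a nondegenerate symmetric bilinear form of arbitrary signature; fix any norm $\|\cdot\|$ on $V$. **Definitions.** In the free associative unital real algebra $\mathbb{R}\langle X_2,X_3,\dots\rangle$ put $$\tilde Q_0:=1,\qquad \tilde Q_k:=-\frac{1}{k(k+1)}\sum_{\ell=2}^{k}\binom{k}{\ell}(\ell-1)\,\ell\,X_\ell\,\tilde Q_{k-\ell}\quad(k\ge 1),\qquad Q_k:=\sum_{\ell=0}^{k}\binom{k}{\ell}\tilde Q_\ell^{*}\,\tilde Q_{k-\ell}\quad(k\ge 0),$$ where $*$ is the algebra anti-automorphism with $X_i^*=X_i$. For polynomial functions $\mathcal{R}^{0)},\mathcal{R}^{1)},\dots$ on $V$ with values in the bilinear forms on $V$, $Q_k(\mathcal{R}^{0)},\mathcal{R}^{1)},\dots)$ is the result of substituting $X_{\ell+2}=\mathcal{R}^{\ell)}$, where a bilinear form $b$ is identified with the endomorphism $A$ given by $\gamma(Ax,y)=b(x,y)$ and multiplication is pointwise composition of endomorphisms; $Q_k$ involves only $\mathcal{R}^{0)},\dots,\mathcal{R}^{k-2)}$.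 A smooth pseudo-Riemannian metric $g$ on an open star-shaped neighbourhood $U\subseteq V$ of $0$ is *in normal coordinates* if for every $\xi\in U$ the straight line $t\mapsto t\xi$, $t\in[0,1]$, is a geodesic. With $\nabla$ the Levi-Civita connection of $g$ and $R(x,y,z,w)=g(\nabla_x\nabla_yz-\nabla_y\nabla_xz-\nabla_{[x,y]}z,\,w)$ its curvature tensor, its symmetrized curvature jet at the origin consists of $$\mathcal{R}^{k)}(\xi;x,y):=\big(\nabla^{k)}_{\xi,\dots,\xi}R\big)(x,\xi,\xi,y)\big|_{0}\qquad(k\ge0).$$ Finally, $\mathcal{N}_k$ is the space of all $h\in\mathrm{Sym}^kV^*\otimes\mathrm{Sym}^2V^*$ with $h(\xi,\dots,\xi;\xi,y)=0$ for all $\xi,y\in V$. **Proposition.** (a) Let $g$ be a metric in normal coordinates on $U$ with $g(0)=\gamma$, and let $(\mathcal{R}^{0)},\mathcal{R}^{1)},\dots)$ be its symmetrized curvature jet at the origin. Then the asymptotic expansion of $g$ at the origin is $\sum_{n\ge0}\frac{1}{n!}Q_n(\mathcal{R}^{0)},\mathcal{R}^{1)},\dots)$, i.e. for every $N\ge 0$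 $$g(\xi)=\sum_{n=0}^{N}\frac{1}{n!}\,Q_n(\mathcal{R}^{0)},\mathcal{R}^{1)},\dots)(\xi)+O(\|\xi\|^{N+1})\qquad(\xi\to0).$$ (b) Conversely, let $k\ge0$ and let $\mathcal{R}^{\ell)}\in\mathcal{N}_{\ell+2}$ be given for $\ell=0,\dots,k$. Then there is $\epsilon>0$ such that the polynomial $$g(\xi)=\sum_{n=0}^{k+2}\frac{1}{n!}\,Q_n(\mathcal{R}^{0)},\dots,\mathcal{R}^{k)})(\xi)$$ defines a metric in normal coordinates for $\|\xi\|<\epsilon$, with $g(0)=\gamma$. Moreover, its symmetrized curvature $k$-jet at the origin is the prescribed one, $(\mathcal{R}^{0)},\dots,\mathcal{R}^{k)})$. -/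

import Mathlib

set_option maxSynthPendingDepth 3

open Filter Topology Asymptotics
open scoped ContDiff

noncomputable section

namespace NormalJet

/-! ### The universal noncommutative polynomials `Q̃_k` and `Q_k` -/

/-- Labels of the free generators `X_2, X_3, …`. -/
abbrev Gen : Type := {n : ℕ // 2 ≤ n}

/-- The free associative unital real algebra on `X_2, X_3, …`. -/
abbrev Free : Type := FreeAlgebra ℝ Gen

/-- The generator `X_{j+2}`. -/
def X (j : ℕ) : Free := FreeAlgebra.ι ℝ (⟨j + 2, Nat.le_add_left 2 j⟩ : Gen)

/-- `Q̃_0 = 1` and, for `k = n + 1 ≥ 1`,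
`Q̃_k = - 1/(k(k+1)) ∑_{ℓ=2}^k (k choose ℓ) (ℓ-1) ℓ X_ℓ Q̃_{k-ℓ}`
(the summation index is `ℓ = j + 2` with `0 ≤ j < n`). -/
def Qtilde : ℕ → Free
  | 0 => 1
  | n + 1 =>
      (-(1 / (((n : ℝ) + 1) * ((n : ℝ) + 2)))) •
        ∑ j : Fin n,
          (((n + 1).choose ((j : ℕ) + 2) : ℝ) * ((j : ℝ) + 1) * ((j : ℝ) + 2)) •
            (X j * Qtilde (n + 1 - ((j : ℕ) + 2)))
  termination_by k => k
  decreasing_by omega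

/-- `Q_k = ∑_{ℓ=0}^k (k choose ℓ) Q̃_ℓ^* Q̃_{k-ℓ}`. Here `star` is Mathlib's involution of the
free algebra: the anti-automorphism that fixes every generator. -/
def Q (k : ℕ) : Free :=
  ∑ l ∈ Finset.range (k + 1), (k.choose l : ℝ) • (star (Qtilde l) * Qtilde (k - l))

variable {V : Type*} [NormedAddCommGroup V] [NormedSpace ℝ V]

/-! ### Metrics, Levi-Civita connection, curvature -/

/-- A nondegenerate symmetric bilinear form, of arbitrary signature. -/
structure IsPseudoEuclidean (b : V →L[ℝ] V →L[ℝ] ℝ) : Prop where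
  symm : ∀ x y, b x y = b y x
  nondegenerate : ∀ x, (∀ y, b x y = 0) → x = 0

/-- A smooth pseudo-Riemannian metric on the open set `U` of the vector space `V`. -/
structure IsPseudoRiemannianOn (g : V → V →L[ℝ] V →L[ℝ] ℝ) (U : Set V) : Prop where
  isOpen : IsOpen U
  smooth : ContDiffOn ℝ ∞ g U
  pseudoEuclidean : ∀ ξ ∈ U, IsPseudoEuclidean (g ξ)

/-- The right-hand side of Koszul's formula for constant vector fields `u, v, w`:
`½ (∂_u g(v,w) + ∂_v g(u,w) - ∂_w g(u,v))`, as a bilinear map in `u, v` with values in the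
dual space. -/
def koszul (g : V → V →L[ℝ] V →L[ℝ] ℝ) (ξ : V) : V →L[ℝ] V →L[ℝ] V →L[ℝ] ℝ :=
  (1 / 2 : ℝ) • (fderiv ℝ g ξ + (fderiv ℝ g ξ).flip -
    ((ContinuousLinearMap.flipₗᵢ ℝ V V ℝ).toContinuousLinearEquiv :
      (V →L[ℝ] V →L[ℝ] ℝ) →L[ℝ] (V →L[ℝ] V →L[ℝ] ℝ)).comp (fderiv ℝ g ξ).flip)

theorem koszul_apply (g : V → V →L[ℝ] V →L[ℝ] ℝ) (ξ u v w : V) :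
    koszul g ξ u v w =
      (1 / 2 : ℝ) * (fderiv ℝ g ξ u v w + fderiv ℝ g ξ v u w - fderiv ℝ g ξ w u v) := rfl

/-- The Levi-Civita connection of `g` in the flat coordinates of `V`: the Christoffel form
`Γ_ξ(u, v) = ∇_u v` for constant vector fields `u, v`, obtained from `koszul` by raising the
index with `g ξ`. -/
def christoffel (g : V → V →L[ℝ] V →L[ℝ] ℝ) (ξ : V) : V →L[ℝ] V →L[ℝ] V :=
  (ContinuousLinearMap.compL ℝ V (V →L[ℝ] ℝ) V (g ξ).inverse).comp (koszul g ξ)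

theorem christoffel_apply (g : V → V →L[ℝ] V →L[ℝ] ℝ) (ξ u v : V) :
    christoffel g ξ u v = (g ξ).inverse (koszul g ξ u v) := rfl

/-- The curvature operator `R(x,y)z = ∇_x∇_y z - ∇_y∇_x z - ∇_{[x,y]} z` of `g` at `ξ`. -/
def curvatureOp (g : V → V →L[ℝ] V →L[ℝ] ℝ) (ξ : V) : V →L[ℝ] V →L[ℝ] V →L[ℝ] V :=
  let S : V →L[ℝ] V →L[ℝ] V →L[ℝ] V :=
    fderiv ℝ (christoffel g) ξ +
      (ContinuousLinearMap.compL ℝ V V V).bilinearComp (christoffel g ξ) (christoffel g ξ)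
  S - S.flip

theorem curvatureOp_apply (g : V → V →L[ℝ] V →L[ℝ] ℝ) (ξ x y z : V) :
    curvatureOp g ξ x y z =
      (fderiv ℝ (christoffel g) ξ x y z + christoffel g ξ x (christoffel g ξ y z)) -
      (fderiv ℝ (christoffel g) ξ y x z + christoffel g ξ y (christoffel g ξ x z)) := rfl

/-- The curvature tensor `R(x,y,z,w) = g(R(x,y)z, w)` of `g` at `ξ`. -/
def curvature (g : V → V →L[ℝ] V →L[ℝ] ℝ) (ξ : V) : V [×4]→L[ℝ] ℝ where
  toFun v := g ξ (curvatureOp g ξ (v 0) (v 1) (v 2)) (v 3)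
  map_update_add' := by
    intro inst v i x y
    obtain rfl : inst = instDecidableEqFin 4 := Subsingleton.elim _ _
    match i with
    | 0 => simp
    | 1 => simp
    | 2 => simp
    | 3 => simp
  map_update_smul' := by
    intro inst v i c x
    obtain rfl : inst = instDecidableEqFin 4 := Subsingleton.elim _ _
    match i with
    | 0 => simp
    | 1 => simp
    | 2 => simp
    | 3 => simp
  cont := by fun_prop

/-- The bilinear map `(A, T) ↦ A · T` for an endomorphism `A` and an `m`-form `T`:
`(A · T)(x_1, …, x_m) = ∑_i T(x_1, …, A x_i, …, x_m)`. -/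
def derivation (m : ℕ) : (V →L[ℝ] V) →L[ℝ] (V [×m]→L[ℝ] ℝ) →L[ℝ] (V [×m]→L[ℝ] ℝ) :=
  ∑ i : Fin m, (ContinuousMultilinearMap.compContinuousLinearMapContinuousMultilinear ℝ
    (fun _ : Fin m => V) (fun _ : Fin m => V) ℝ).toContinuousLinearMap
      (fun _ => ContinuousLinearMap.id ℝ V) i

theorem derivation_apply {m : ℕ} (A : V →L[ℝ] V) (T : V [×m]→L[ℝ] ℝ) (v : Fin m → V) :
    derivation (V := V) m A T v = ∑ i, T (Function.update v i (A (v i))) := by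
  simp only [derivation, _root_.sum_apply]
  refine Finset.sum_congr rfl fun i _ => ?_
  change T (fun j => Function.update (fun _ => ContinuousLinearMap.id ℝ V) i A j (v j)) = _
  congr 1
  funext j
  by_cases h : j = i
  · subst h
    simp
  · simp [h]

/-- The covariant derivative of a covariant tensor field of order `m` with respect to the
connection `Γ`; the new slot (the direction of differentiation) is the first one. -/
def covDeriv (Γ : V → V →L[ℝ] V →L[ℝ] V) {m : ℕ} (T : V → V [×m]→L[ℝ] ℝ) (ξ : V) :
    V [×(m + 1)]→L[ℝ] ℝ :=
  (fderiv ℝ T ξ - ((derivation (V := V) m).flip (T ξ)).comp (Γ ξ)).uncurryLeft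

theorem covDeriv_apply (Γ : V → V →L[ℝ] V →L[ℝ] V) {m : ℕ} (T : V → V [×m]→L[ℝ] ℝ) (ξ x : V)
    (v : Fin m → V) :
    covDeriv Γ T ξ (Fin.cons x v) =
      fderiv ℝ T ξ x v - ∑ i, T ξ (Function.update v i (Γ ξ x (v i))) := by
  simp [covDeriv, derivation_apply]

/-- The `k`-fold iterated covariant derivative `∇^{k)} T`; the first `k` slots are the
directions of differentiation. -/
def iterCovDeriv (Γ : V → V →L[ℝ] V →L[ℝ] V) {m : ℕ} (T : V → V [×m]→L[ℝ] ℝ) :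
    (k : ℕ) → V → V [×(m + k)]→L[ℝ] ℝ
  | 0 => T
  | k + 1 => covDeriv Γ (iterCovDeriv Γ T k)

/-- The list of arguments `(ξ, …, ξ, x, ξ, ξ, y)`, with `k` entries `ξ` before `x`. -/
def jacobiArgs {V : Type*} (k : ℕ) (ξ x y : V) : Fin (4 + k) → V :=
  Function.update (Function.update (fun _ => ξ) ⟨k, by omega⟩ x) ⟨k + 3, by omega⟩ y

theorem jacobiArgs_swap {V : Type*} (k : ℕ) (ξ x y : V) :
    jacobiArgs k ξ x y =
      Function.update (Function.update (fun _ => ξ) ⟨k + 3, by omega⟩ y) ⟨k, by omega⟩ x :=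
  Function.update_comm (by simp) _ _ _

/-- The symmetrized `k`-th covariant derivative of the curvature tensor at the origin,
`𝓡^{k)}(ξ; x, y) = (∇^{k)}_{ξ,…,ξ} R)(x, ξ, ξ, y)`, as a polynomial function of `ξ` with values
in the bilinear forms. -/
def symCurvature [FiniteDimensional ℝ V] (g : V → V →L[ℝ] V →L[ℝ] ℝ) (k : ℕ) (ξ : V) :
    V →L[ℝ] V →L[ℝ] ℝ :=
  LinearMap.toContinuousBilinearMap
    (LinearMap.mk₂ ℝ
      (fun x y => iterCovDeriv (christoffel g) (curvature g) k 0 (jacobiArgs k ξ x y))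
      (by intro x x' y; simp only [jacobiArgs_swap, ContinuousMultilinearMap.map_update_add])
      (by intro c x y; simp only [jacobiArgs_swap, ContinuousMultilinearMap.map_update_smul])
      (by intro x y y'; simp only [jacobiArgs, ContinuousMultilinearMap.map_update_add])
      (by intro c x y; simp only [jacobiArgs, ContinuousMultilinearMap.map_update_smul]))

theorem symCurvature_apply [FiniteDimensional ℝ V] (g : V → V →L[ℝ] V →L[ℝ] ℝ) (k : ℕ)
    (ξ x y : V) :
    symCurvature g k ξ x y =
      iterCovDeriv (christoffel g) (curvature g) k 0 (jacobiArgs k ξ x y) := rfl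

/-! ### Normal coordinates -/

/-- `c` satisfies the geodesic equation `c'' + Γ_c(c', c') = 0` of `g` at the times `t ∈ s`. -/
def IsGeodesicOn (g : V → V →L[ℝ] V →L[ℝ] ℝ) (c : ℝ → V) (s : Set ℝ) : Prop :=
  ∀ t ∈ s, DifferentiableAt ℝ c t ∧
    HasDerivAt (deriv c) (-(christoffel g (c t) (deriv c t) (deriv c t))) t

/-- `g` is a pseudo-Riemannian metric in normal coordinates on the open star-shaped
neighbourhood `U` of the origin: the straight lines `t ↦ t ξ`, `0 ≤ t ≤ 1`, are geodesics for
all `ξ ∈ U`. -/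
structure IsNormalMetricOn (g : V → V →L[ℝ] V →L[ℝ] ℝ) (U : Set V) : Prop where
  zero_mem : (0 : V) ∈ U
  starShaped : StarConvex ℝ (0 : V) U
  metric : IsPseudoRiemannianOn g U
  geodesic : ∀ ξ ∈ U, IsGeodesicOn g (fun t : ℝ => t • ξ) (Set.Icc 0 1)

/-- The space `𝓝_k` of all `h ∈ Sym^k V^* ⊗ Sym^2 V^*` with `h(ξ,…,ξ; ξ, y) = 0` for all
`ξ` and `y`. -/
def normalTensors (V : Type*) [NormedAddCommGroup V] [NormedSpace ℝ V] (k : ℕ) :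
    Submodule ℝ (V [×k]→L[ℝ] (V →L[ℝ] V →L[ℝ] ℝ)) where
  carrier := {h | (∀ (σ : Equiv.Perm (Fin k)) (v : Fin k → V), h (v ∘ σ) = h v) ∧
    (∀ (v : Fin k → V) (x y : V), h v x y = h v y x) ∧
    ∀ ξ y : V, h (fun _ => ξ) ξ y = 0}
  zero_mem' := ⟨fun _ _ => rfl, fun _ _ _ => rfl, fun _ _ => rfl⟩
  add_mem' := by
    rintro a b ⟨ha1, ha2, ha3⟩ ⟨hb1, hb2, hb3⟩
    refine ⟨fun σ v => ?_, fun v x y => ?_, fun ξ y => ?_⟩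
    · simp [ha1 σ v, hb1 σ v]
    · simp [ha2 v x y, hb2 v x y]
    · simp [ha3, hb3]
  smul_mem' := by
    rintro c a ⟨ha1, ha2, ha3⟩
    refine ⟨fun σ v => ?_, fun v x y => ?_, fun ξ y => ?_⟩
    · simp [ha1 σ v]
    · simp [ha2 v x y]
    · simp [ha3]

/-! ### Substitution and the Taylor polynomial -/

/-- The endomorphism `A` of `V` with `γ(A x, y) = b(x, y)`. -/
def toEnd (γ b : V →L[ℝ] V →L[ℝ] ℝ) : V →L[ℝ] V := γ.inverse.comp b

/-- The bilinear form `(x, y) ↦ γ(A x, y)`. -/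
def toForm (γ : V →L[ℝ] V →L[ℝ] ℝ) (A : V →L[ℝ] V) : V →L[ℝ] V →L[ℝ] ℝ := γ.comp A

/-- The value `P(𝓡^{0)}, 𝓡^{1)}, …)` of a noncommutative polynomial `P` under the substitution
`X_{l+2} = 𝓡^{l)}`, in the algebra of `End V`-valued functions on `V` with pointwise
composition; bilinear forms are identified with endomorphisms via `γ`. -/
def substitute (γ : V →L[ℝ] V →L[ℝ] ℝ) (r : ℕ → V → V →L[ℝ] V →L[ℝ] ℝ) (P : Free) :
    V → (V →L[ℝ] V) :=
  FreeAlgebra.lift ℝ (fun (n : Gen) (ξ : V) => toEnd γ (r ((n : ℕ) - 2) ξ)) P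

/-- The `n`-th term `(1/n!) Q_n(𝓡^{0)}, 𝓡^{1)}, …)`, as a function on `V` with values in the
bilinear forms. -/
def term (γ : V →L[ℝ] V →L[ℝ] ℝ) (r : ℕ → V → V →L[ℝ] V →L[ℝ] ℝ) (n : ℕ) (ξ : V) :
    V →L[ℝ] V →L[ℝ] ℝ :=
  (1 / (n.factorial : ℝ)) • toForm γ (substitute γ r (Q n) ξ)

/-- The polynomial `∑_{n=0}^N (1/n!) Q_n(𝓡^{0)}, 𝓡^{1)}, …)`. -/
def taylorPoly (γ : V →L[ℝ] V →L[ℝ] ℝ) (r : ℕ → V → V →L[ℝ] V →L[ℝ] ℝ) (N : ℕ) (ξ : V) :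
    V →L[ℝ] V →L[ℝ] ℝ :=
  ∑ n ∈ Finset.range (N + 1), term γ r n ξ

end NormalJet

end

/-! In normal coordinates the variation of rays makes J(t) = t y a Jacobi field along t ↦ t ξ. Write
D = d/dt + Γ_{tξ}(ξ, ·). Applying Dⁿ to D²J = -R(J, ξ)ξ at t = 0 gives a recursion for c_n = DⁿJ(0)
with c_0 = 0, c_1 = y. Its coefficients are the 𝓡^{m)}(ξ), and its solution is c_{n+1} = (n+1) Q̃_n
y (`jacobi_coeff`). Since g(tξ)(ty, tz) = t² g(tξ)(y, z) and D is metric, Leibniz' rule for order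
n+2 at t = 0 identifies the n-th radial derivative of g with γ(Q_n y, z) (`jacobi_form_coeff`,
`iterate_deriv_ray_metric`). The involution in Q_n is the γ-adjoint, because the 𝓡^{m)} are
self-adjoint. Taylor's formula along rays, with a remainder uniform in the direction, then gives
(a).

For (b), normal tensors annihilate ξ, so only the constant term of P survives on it: P_ξ(ξ, ·) =
γ(ξ, ·). This Gauss-lemma condition forces Γ_ξ(ξ, ξ) = 0, hence rays are geodesics
(`christoffel_self_of_radial`). The radial derivatives of P are now Q_n of its own curvature jet,
and by homogeneity also Q_n of the prescribed tensors. As X_{n+2} enters Q_{n+2} linearly with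
nonzero coefficient, the two jets agree by induction (`eq_of_evalAt_Q_eq`). -/

noncomputable section

namespace NormalJet

/-! ### Evaluation of the universal polynomials in an algebra -/

section Algebra

variable {R : Type*} [Ring R] [Algebra ℝ R]

/-- The substitution `X_{l+2} = x l` in an arbitrary algebra. -/
def evalAt (x : ℕ → R) : Free →ₐ[ℝ] R :=
  FreeAlgebra.lift ℝ fun n : Gen => x ((n : ℕ) - 2)

theorem evalAt_X (x : ℕ → R) (j : ℕ) : evalAt x (X j) = x j := by
  simp [evalAt, X]

theorem evalAt_Qtilde_zero (x : ℕ → R) : evalAt x (Qtilde 0) = 1 := by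
  rw [Qtilde, map_one]

theorem evalAt_Qtilde_succ (x : ℕ → R) (n : ℕ) :
    evalAt x (Qtilde (n + 1)) = (-(1 / (((n : ℝ) + 1) * ((n : ℝ) + 2)))) •
      ∑ j ∈ Finset.range n, (((n + 1).choose (j + 2) : ℝ) * ((j : ℝ) + 1) * ((j : ℝ) + 2)) •
        (x j * evalAt x (Qtilde (n - (j + 1)))) := by
  rw [Qtilde]
  simp only [map_smul, map_sum, map_mul, evalAt_X]
  rw [← Fin.sum_univ_eq_sum_range (fun j => (((n + 1).choose (j + 2) : ℝ) * ((j : ℝ) + 1) *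
    ((j : ℝ) + 2)) • (x j * evalAt x (Qtilde (n - (j + 1))))) n]
  congr 1
  refine Finset.sum_congr rfl fun j _ => ?_
  rw [show n + 1 - ((j : ℕ) + 2) = n - ((j : ℕ) + 1) by omega]

/-- The involution only reverses products, so it amounts to evaluating in the opposite algebra.
Identities for Q̃ valid in every algebra thus transfer to its star. -/
theorem evalAt_star (x : ℕ → R) (P : Free) :
    evalAt x (star P) = (evalAt (fun j => MulOpposite.op (x j)) P).unop := by
  induction P using FreeAlgebra.induction with
  | grade0 r =>
    rw [FreeAlgebra.star_algebraMap]
    simp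
  | grade1 n =>
    rw [FreeAlgebra.star_ι]
    simp [evalAt]
  | mul a b ha hb => simp [ha, hb]
  | add a b ha hb => simp [ha, hb]

theorem evalAt_Q (x : ℕ → R) (n : ℕ) :
    evalAt x (Q n) = ∑ l ∈ Finset.range (n + 1),
      (n.choose l : ℝ) • (evalAt x (star (Qtilde l)) * evalAt x (Qtilde (n - l))) := by
  simp [Q]

theorem evalAt_Qtilde_congr {x x' : ℕ → R} {n : ℕ} (h : ∀ j, j + 2 ≤ n → x j = x' j) :
    evalAt x (Qtilde n) = evalAt x' (Qtilde n) := by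
  induction n using Nat.strong_induction_on with
  | _ n ih =>
    cases n with
    | zero => simp only [evalAt_Qtilde_zero]
    | succ n =>
      rw [evalAt_Qtilde_succ, evalAt_Qtilde_succ]
      congr 1
      refine Finset.sum_congr rfl fun j hj => ?_
      have hj := Finset.mem_range.1 hj
      rw [h j (by omega), ih (n - (j + 1)) (by omega) fun i hi => h i (by omega)]

theorem evalAt_star_Qtilde_congr {x x' : ℕ → R} {n : ℕ} (h : ∀ j, j + 2 ≤ n → x j = x' j) :
    evalAt x (star (Qtilde n)) = evalAt x' (star (Qtilde n)) := by
  rw [evalAt_star, evalAt_star]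
  exact congrArg _ (evalAt_Qtilde_congr fun j hj => congrArg _ (h j hj))

theorem evalAt_Q_congr {x x' : ℕ → R} {n : ℕ} (h : ∀ j, j + 2 ≤ n → x j = x' j) :
    evalAt x (Q n) = evalAt x' (Q n) := by
  rw [evalAt_Q, evalAt_Q]
  refine Finset.sum_congr rfl fun l hl => ?_
  have hl := Finset.mem_range.1 hl
  rw [evalAt_star_Qtilde_congr (n := l) fun j hj => h j (by omega),
    evalAt_Qtilde_congr (n := n - l) fun j hj => h j (by omega)]

/-- Weighted homogeneity with X_j of weight j; it makes the truncated expansion a polynomial in t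
along each ray. -/
theorem evalAt_Qtilde_scale (x : ℕ → R) (t : ℝ) (n : ℕ) :
    evalAt (fun j => t ^ (j + 2) • x j) (Qtilde n) = t ^ n • evalAt x (Qtilde n) := by
  induction n using Nat.strong_induction_on with
  | _ n ih =>
    cases n with
    | zero => simp only [evalAt_Qtilde_zero, pow_zero, one_smul]
    | succ n =>
      rw [evalAt_Qtilde_succ, evalAt_Qtilde_succ]
      simp only [Finset.smul_sum]
      refine Finset.sum_congr rfl fun j hj => ?_
      have hj := Finset.mem_range.1 hj
      rw [ih (n - (j + 1)) (by omega), smul_mul_smul_comm, ← pow_add,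
        show j + 2 + (n - (j + 1)) = n + 1 by omega]
      simp only [smul_smul]
      congr 1
      ring

theorem evalAt_star_Qtilde_scale (x : ℕ → R) (t : ℝ) (n : ℕ) :
    evalAt (fun j => t ^ (j + 2) • x j) (star (Qtilde n)) =
      t ^ n • evalAt x (star (Qtilde n)) := by
  rw [evalAt_star, evalAt_star]
  exact congrArg MulOpposite.unop (evalAt_Qtilde_scale (fun j => MulOpposite.op (x j)) t n)

theorem evalAt_Q_scale (x : ℕ → R) (t : ℝ) (n : ℕ) :
    evalAt (fun j => t ^ (j + 2) • x j) (Q n) = t ^ n • evalAt x (Q n) := by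
  rw [evalAt_Q, evalAt_Q, Finset.smul_sum]
  refine Finset.sum_congr rfl fun l hl => ?_
  have hl := Finset.mem_range.1 hl
  rw [evalAt_star_Qtilde_scale, evalAt_Qtilde_scale, smul_mul_smul_comm, ← pow_add,
    show l + (n - l) = n by omega, smul_comm (t ^ n)]

theorem evalAt_Q_zero (x : ℕ → R) : evalAt x (Q 0) = 1 := by
  simp [evalAt_Q, evalAt_star, evalAt_Qtilde_zero]

/-- X_{n+2} occurs in Q̃_{n+2} only in the last summand, next to Q̃_0 = 1, with coefficient
(n+1)(n+2) / ((n+2)(n+3)) up to sign. -/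
theorem evalAt_Qtilde_sub {x x' : ℕ → R} {n : ℕ} (h : ∀ j < n, x j = x' j) :
    evalAt x (Qtilde (n + 2)) - evalAt x' (Qtilde (n + 2)) =
      (-(((n : ℝ) + 1) / ((n : ℝ) + 3))) • (x n - x' n) := by
  have hsum : ∀ j ∈ Finset.range n,
      (((n + 1 + 1).choose (j + 2) : ℝ) * ((j : ℝ) + 1) * ((j : ℝ) + 2)) •
        (x j * evalAt x (Qtilde (n + 1 - (j + 1)))) =
      (((n + 1 + 1).choose (j + 2) : ℝ) * ((j : ℝ) + 1) * ((j : ℝ) + 2)) •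
        (x' j * evalAt x' (Qtilde (n + 1 - (j + 1)))) := by
    intro j hj
    have hj := Finset.mem_range.1 hj
    rw [h j hj, evalAt_Qtilde_congr fun i hi => h i (by omega)]
  rw [evalAt_Qtilde_succ, evalAt_Qtilde_succ, Finset.sum_range_succ, Finset.sum_range_succ,
    Finset.sum_congr rfl hsum, ← smul_sub, add_sub_add_left_eq_sub, ← smul_sub, smul_smul]
  simp only [Nat.sub_self, evalAt_Qtilde_zero, mul_one]
  congr 1
  simp only [show n + 1 + 1 = n + 2 from rfl, Nat.choose_self]
  push_cast
  field_simp
  ring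

theorem evalAt_star_Qtilde_sub {x x' : ℕ → R} {n : ℕ} (h : ∀ j < n, x j = x' j) :
    evalAt x (star (Qtilde (n + 2))) - evalAt x' (star (Qtilde (n + 2))) =
      (-(((n : ℝ) + 1) / ((n : ℝ) + 3))) • (x n - x' n) := by
  rw [evalAt_star, evalAt_star]
  exact congrArg MulOpposite.unop (evalAt_Qtilde_sub (x := fun j => MulOpposite.op (x j))
    (x' := fun j => MulOpposite.op (x' j)) fun j hj => congrArg _ (h j hj))

/-- `Q_{n+2}` determines `X_{n+2}` once the generators of lower index are known. -/
theorem eq_of_evalAt_Q_eq {x x' : ℕ → R} {n : ℕ} (h : ∀ j < n, x j = x' j)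
    (hQ : evalAt x (Q (n + 2)) = evalAt x' (Q (n + 2))) : x n = x' n := by
  have key : evalAt x (Q (n + 2)) - evalAt x' (Q (n + 2)) =
      (2 * -(((n : ℝ) + 1) / ((n : ℝ) + 3))) • (x n - x' n) := by
    -- Interior summands involve only lower generators. The two end summands, Q̃_{n+2} and its star,
    -- each contribute -(n+1)/(n+3).
    have hsum : ∀ l ∈ Finset.range (n + 1),
        ((n + 2).choose (l + 1) : ℝ) •
          (evalAt x (star (Qtilde (l + 1))) * evalAt x (Qtilde (n + 2 - (l + 1)))) =
        ((n + 2).choose (l + 1) : ℝ) •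
          (evalAt x' (star (Qtilde (l + 1))) * evalAt x' (Qtilde (n + 2 - (l + 1)))) := by
      intro l hl
      have hl := Finset.mem_range.1 hl
      rw [evalAt_star_Qtilde_congr (n := l + 1) fun j hj => h j (by omega),
        evalAt_Qtilde_congr (n := n + 2 - (l + 1)) fun j hj => h j (by omega)]
    rw [evalAt_Q, evalAt_Q, Finset.sum_range_succ _ (n + 2), Finset.sum_range_succ _ (n + 2),
      Finset.sum_range_succ' _ (n + 1), Finset.sum_range_succ' _ (n + 1),
      Finset.sum_congr rfl hsum]
    simp only [Nat.choose_zero_right, Nat.choose_self, Nat.sub_self, Nat.sub_zero,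
      evalAt_Qtilde_zero, evalAt_star x (Qtilde 0), evalAt_star x' (Qtilde 0),
      Nat.cast_one, one_smul, mul_one, MulOpposite.unop_one, one_mul]
    rw [two_mul, add_smul]
    nth_rewrite 1 [← evalAt_Qtilde_sub h]
    rw [← evalAt_star_Qtilde_sub h]
    abel
  rw [hQ, sub_self, eq_comm, smul_eq_zero] at key
  have hn : (2 * -(((n : ℝ) + 1) / ((n : ℝ) + 3))) ≠ 0 := by
    have : 0 < ((n : ℝ) + 1) / ((n : ℝ) + 3) := by positivity
    linarith
  exact sub_eq_zero.1 (key.resolve_left hn)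

end Algebra

/-! ### Self-adjoint substitutions and Taylor coefficients of Jacobi fields -/

section Endomorphisms

variable {V : Type*} [NormedAddCommGroup V] [NormedSpace ℝ V]

theorem substitute_apply (γ : V →L[ℝ] V →L[ℝ] ℝ) (r : ℕ → V → V →L[ℝ] V →L[ℝ] ℝ) (P : Free)
    (ξ : V) : substitute γ r P ξ = evalAt (fun l => toEnd γ (r l ξ)) P := by
  induction P using FreeAlgebra.induction with
  | grade0 c => simp [substitute]
  | grade1 n => simp [substitute, evalAt]
  | mul a b ha hb =>
    rw [map_mul, ← ha, ← hb]
    simp [substitute]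
  | add a b ha hb =>
    rw [map_add, ← ha, ← hb]
    simp [substitute]

/-- The star and the β-adjoint both reverse products and agree on the self-adjoint generators. -/
theorem evalAt_adjoint {β : V →L[ℝ] V →L[ℝ] ℝ} {x : ℕ → V →L[ℝ] V}
    (hx : ∀ j y z, β (x j y) z = β y (x j z)) (P : Free) (y z : V) :
    β (evalAt x (star P) y) z = β y (evalAt x P z) := by
  induction P using FreeAlgebra.induction generalizing y z with
  | grade0 c =>
    rw [FreeAlgebra.star_algebraMap]
    simp [Algebra.algebraMap_eq_smul_one]
  | grade1 n =>
    rw [FreeAlgebra.star_ι]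
    simp [evalAt, hx]
  | mul a b ha hb => simp [ha, hb]
  | add a b ha hb => simp [ha, hb]

theorem form_evalAt_Q {β : V →L[ℝ] V →L[ℝ] ℝ} {x : ℕ → V →L[ℝ] V}
    (hx : ∀ j y z, β (x j y) z = β y (x j z)) (n : ℕ) (y z : V) :
    β (evalAt x (Q n) y) z = ∑ p ∈ Finset.HasAntidiagonal.antidiagonal n,
      (n.choose p.1 : ℝ) * β (evalAt x (Qtilde p.1) y) (evalAt x (Qtilde p.2) z) := by
  -- The starred factor moves to the second argument, so the two indices trade places.
  rw [evalAt_Q, ← Finset.Nat.sum_antidiagonal_swap,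
    Finset.Nat.sum_antidiagonal_eq_sum_range_succ_mk]
  simp only [_root_.sum_apply, map_sum]
  refine Finset.sum_congr rfl fun l hl => ?_
  have hl := Finset.mem_range.1 hl
  simp only [Prod.swap_prod_mk]
  rw [Nat.choose_symm (by omega)]
  simp [evalAt_adjoint hx]

theorem form_evalAt_Q_symm {β : V →L[ℝ] V →L[ℝ] ℝ} (hβ : ∀ x y, β x y = β y x)
    {x : ℕ → V →L[ℝ] V} (hx : ∀ j y z, β (x j y) z = β y (x j z)) (n : ℕ) (y z : V) :
    β (evalAt x (Q n) y) z = β (evalAt x (Q n) z) y := by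
  rw [form_evalAt_Q hx, form_evalAt_Q hx, ← Finset.Nat.sum_antidiagonal_swap]
  refine Finset.sum_congr rfl fun p hp => ?_
  have hp := Finset.HasAntidiagonal.mem_antidiagonal.1 hp
  simp only [Prod.fst_swap, Prod.snd_swap]
  rw [hβ, ← hp, Nat.choose_symm_add]

/-- Q̃_{n+1} has no constant term: every monomial ends in a generator, which hits v first. -/
theorem evalAt_Qtilde_succ_apply_eq_zero {x : ℕ → V →L[ℝ] V} {n : ℕ} {v : V}
    (hv : ∀ j, x j v = 0) : evalAt x (Qtilde (n + 1)) v = 0 := by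
  induction n using Nat.strong_induction_on with
  | _ n ih =>
    rw [evalAt_Qtilde_succ]
    simp only [_root_.smul_apply, _root_.sum_apply]
    rw [Finset.sum_eq_zero, smul_zero]
    intro j hj
    have hj := Finset.mem_range.1 hj
    rw [mul_apply_eq_comp]
    rcases Nat.eq_zero_or_pos (n - (j + 1)) with h | h
    · rw [h, evalAt_Qtilde_zero, one_apply_eq_self, hv, smul_zero]
    · obtain ⟨m, hm⟩ := Nat.exists_eq_add_of_lt h
      rw [show n - (j + 1) = m + 1 by omega, ih m (by omega), map_zero, smul_zero]

theorem form_evalAt_Q_succ_eq_zero {β : V →L[ℝ] V →L[ℝ] ℝ} {x : ℕ → V →L[ℝ] V}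
    (hx : ∀ j y z, β (x j y) z = β y (x j z)) {v : V} (hv : ∀ j, x j v = 0) (n : ℕ) (w : V) :
    β (evalAt x (Q (n + 1)) v) w = 0 := by
  rw [form_evalAt_Q hx, Finset.sum_eq_zero]
  rintro ⟨i, j⟩ hp
  have hp : i + j = n + 1 := Finset.HasAntidiagonal.mem_antidiagonal.1 hp
  cases i with
  | succ i => simp [evalAt_Qtilde_succ_apply_eq_zero hv]
  | zero =>
    obtain rfl : j = n + 1 := by omega
    -- Here v is paired with Q̃_{n+1} w; self-adjointness moves the leftmost generator back onto v.
    simp [evalAt_Qtilde_zero, evalAt_Qtilde_succ x n, ← hx, hv]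

/-- Matches the coefficients defining Q̃ with the Leibniz binomial n choose j times the factor n - j
carried by c_{n-j}. -/
theorem choose_mul_sub_eq {n j : ℕ} (hj : j < n) :
    ((n + 1).choose (j + 2) : ℝ) * ((j : ℝ) + 1) * ((j : ℝ) + 2) =
      ((n : ℝ) + 1) * (n.choose j : ℝ) * ((n - (j + 1) : ℕ) + 1 : ℝ) := by
  have h1 := Nat.add_one_mul_choose_eq n j
  have h2 := Nat.choose_succ_right_eq (n + 1) (j + 1)
  have h3 : n + 1 - (j + 1) = n - (j + 1) + 1 := by omega
  rw [h3] at h2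
  have h1' : ((n : ℝ) + 1) * n.choose j = (n + 1).choose (j + 1) * ((j : ℝ) + 1) := by
    exact_mod_cast h1
  have h2' : ((n + 1).choose (j + 2) : ℝ) * ((j : ℝ) + 2) =
      (n + 1).choose (j + 1) * ((n - (j + 1) : ℕ) + 1 : ℝ) := by
    have : ((n + 1).choose (j + 1 + 1) : ℝ) * ((j : ℝ) + 1 + 1) =
      (n + 1).choose (j + 1) * ((n - (j + 1) : ℕ) + 1 : ℝ) := by exact_mod_cast h2
    rw [← this]
    ring
  rw [h1', mul_right_comm, h2']
  ring

/-- The Taylor coefficients of a solution of the Jacobi equation `J'' = - R J`, `J(0) = 0`. -/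
theorem jacobi_coeff {x : ℕ → V →L[ℝ] V} {c : ℕ → V} (h0 : c 0 = 0)
    (h : ∀ n, c (n + 2) = -∑ p ∈ Finset.HasAntidiagonal.antidiagonal n, (n.choose p.1 : ℝ) • x p.1 (c p.2))
    (n : ℕ) : c (n + 1) = ((n : ℝ) + 1) • evalAt x (Qtilde n) (c 1) := by
  induction n using Nat.strong_induction_on with
  | _ n ih =>
    cases n with
    | zero => simp [evalAt_Qtilde_zero]
    | succ n =>
      -- The top term contains c_0 = 0, which leaves exactly the range j < n of the recursion for
      -- Q̃.
      rw [h, Finset.Nat.sum_antidiagonal_eq_sum_range_succ_mk, Finset.sum_range_succ]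
      simp only [Nat.sub_self, h0, map_zero, smul_zero, add_zero]
      rw [evalAt_Qtilde_succ]
      simp only [_root_.smul_apply, _root_.sum_apply, smul_smul]
      rw [← Finset.sum_neg_distrib, Finset.smul_sum]
      refine Finset.sum_congr rfl fun j hj => ?_
      have hj := Finset.mem_range.1 hj
      rw [show n - j = n - (j + 1) + 1 by omega, ih (n - (j + 1)) (by omega), map_smul, smul_smul,
        smul_smul, ← neg_smul, mul_apply_eq_comp, choose_mul_sub_eq hj]
      congr 1
      push_cast
      field_simp
      ring

theorem choose_add_mul_eq (i j : ℕ) :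
    ((i + j + 2).choose (i + 1) : ℝ) * (((i : ℝ) + 1) * ((j : ℝ) + 1)) =
      ((i + j : ℕ) + 2 : ℝ) * ((i + j : ℕ) + 1) * ((i + j).choose i : ℝ) := by
  have h1 := Nat.add_one_mul_choose_eq (i + j + 1) i
  have h2 := Nat.add_one_mul_choose_eq (i + j) j
  have h3 : (i + j + 1).choose (j + 1) = (i + j + 1).choose i := by
    have := Nat.choose_symm_add (a := i) (b := j + 1)
    rw [← add_assoc] at this
    exact this.symm
  have h4 : (i + j).choose j = (i + j).choose i := (Nat.choose_symm_add).symm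
  rw [h3, h4] at h2
  have h1' : (((i + j : ℕ) : ℝ) + 2) * (i + j + 1).choose i =
      (i + j + 2).choose (i + 1) * ((i : ℝ) + 1) := by
    have : (((i + j : ℕ) : ℝ) + 1 + 1) * (i + j + 1).choose i =
      (i + j + 2).choose (i + 1) * ((i : ℝ) + 1) := by exact_mod_cast h1
    rw [← this]
    ring
  have h2' : (((i + j : ℕ) : ℝ) + 1) * (i + j).choose i =
      (i + j + 1).choose i * ((j : ℝ) + 1) := by exact_mod_cast h2
  rw [← mul_assoc, ← h1', mul_assoc, ← h2', mul_assoc]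

/-- The end terms vanish with c_0 and d_0; in the others the weights (i+1)(j+1) turn n+2 choose i+1
into (n+2)(n+1) times n choose i. -/
theorem jacobi_form_coeff {β : V →L[ℝ] V →L[ℝ] ℝ} {x : ℕ → V →L[ℝ] V}
    (hx : ∀ j y z, β (x j y) z = β y (x j z)) {c d : ℕ → V} {y z : V} (hc0 : c 0 = 0)
    (hd0 : d 0 = 0) (hc : ∀ n, c (n + 1) = ((n : ℝ) + 1) • evalAt x (Qtilde n) y)
    (hd : ∀ n, d (n + 1) = ((n : ℝ) + 1) • evalAt x (Qtilde n) z) (n : ℕ) :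
    ∑ p ∈ Finset.HasAntidiagonal.antidiagonal (n + 2), ((n + 2).choose p.1 : ℝ) * β (c p.1) (d p.2) =
      ((n : ℝ) + 2) * ((n : ℝ) + 1) * β (evalAt x (Q n) y) z := by
  rw [Finset.Nat.antidiagonal_succ_succ', form_evalAt_Q hx, Finset.mul_sum]
  simp only [Finset.sum_cons, hc0, hd0, map_zero, _root_.zero_apply, mul_zero, zero_add,
    Finset.sum_map]
  refine Finset.sum_congr rfl ?_
  rintro ⟨i, j⟩ hp
  obtain rfl : i + j = n := Finset.HasAntidiagonal.mem_antidiagonal.1 hp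
  change ((i + j + 2).choose (i + 1) : ℝ) * β (c (i + 1)) (d (j + 1)) = _
  simp only [hc, hd, map_smul, _root_.smul_apply, smul_eq_mul]
  linear_combination β (evalAt x (Qtilde i) y) (evalAt x (Qtilde j) z) * choose_add_mul_eq i j

end Endomorphisms

section Riemannian

variable {V : Type*} [NormedAddCommGroup V] [NormedSpace ℝ V]

/-! ### The Levi-Civita connection and the symmetries of the curvature -/

theorem IsPseudoEuclidean.isInvertible [FiniteDimensional ℝ V] {b : V →L[ℝ] V →L[ℝ] ℝ}
    (hb : IsPseudoEuclidean b) : b.IsInvertible := by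
  have hinj : Function.Injective (b : V →ₗ[ℝ] V →L[ℝ] ℝ) := by
    rw [injective_iff_map_eq_zero]
    intro x hx
    exact hb.nondegenerate x fun y => congrArg (fun φ : V →L[ℝ] ℝ => φ y) hx
  have hrank : Module.finrank ℝ V = Module.finrank ℝ (V →L[ℝ] ℝ) := by
    rw [← (LinearMap.toContinuousLinearMap (𝕜 := ℝ) (E := V) (F' := ℝ)).finrank_eq]
    exact (Subspace.dual_finrank_eq).symm
  refine ⟨(LinearMap.linearEquivOfInjective _ hinj hrank).toContinuousLinearEquiv, ?_⟩
  ext x y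
  rfl

theorem isPseudoEuclidean_of_isInvertible {b : V →L[ℝ] V →L[ℝ] ℝ} (hb : b.IsInvertible)
    (hsymm : ∀ x y, b x y = b y x) : IsPseudoEuclidean b := by
  refine ⟨hsymm, fun x hx => ?_⟩
  apply hb.injective
  rw [map_zero]
  ext y
  exact hx y

theorem koszul_symm {g : V → V →L[ℝ] V →L[ℝ] ℝ} {ξ : V}
    (h : ∀ u v w, fderiv ℝ g ξ u v w = fderiv ℝ g ξ u w v) (u v w : V) :
    koszul g ξ u v w = koszul g ξ v u w := by
  rw [koszul_apply, koszul_apply, h w u v]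
  ring

theorem curvatureOp_swap (g : V → V →L[ℝ] V →L[ℝ] ℝ) (ξ x y z : V) :
    curvatureOp g ξ x y z = -curvatureOp g ξ y x z := by
  simp only [curvatureOp_apply]
  abel

namespace IsPseudoRiemannianOn

variable {g : V → V →L[ℝ] V →L[ℝ] ℝ} {U : Set V}

theorem mem_nhds (hg : IsPseudoRiemannianOn g U) {ξ : V} (hξ : ξ ∈ U) : U ∈ 𝓝 ξ :=
  hg.isOpen.mem_nhds hξ

theorem fderiv_symm (hg : IsPseudoRiemannianOn g U) {ξ : V} (hξ : ξ ∈ U) (u v w : V) :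
    fderiv ℝ g ξ u v w = fderiv ℝ g ξ u w v := by
  have hd : DifferentiableAt ℝ g ξ :=
    (hg.smooth.contDiffAt (hg.mem_nhds hξ)).differentiableAt (by simp)
  have h1 : HasFDerivAt (fun p => (g p).flip) _ ξ :=
    (ContinuousLinearMap.flipₗᵢ ℝ V V ℝ).toContinuousLinearEquiv.hasFDerivAt.comp ξ hd.hasFDerivAt
  have h2 : (fun p => (g p).flip) =ᶠ[𝓝 ξ] g := by
    filter_upwards [hg.mem_nhds hξ] with p hp
    ext x y
    exact (hg.pseudoEuclidean p hp).symm y x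
  have h3 := (h1.congr_of_eventuallyEq h2.symm).unique hd.hasFDerivAt
  have h4 := congrArg (fun L : V →L[ℝ] V →L[ℝ] V →L[ℝ] ℝ => L u w v) h3
  exact h4

theorem differentiableAt (hg : IsPseudoRiemannianOn g U) {ξ : V} (hξ : ξ ∈ U) :
    DifferentiableAt ℝ g ξ :=
  (hg.smooth.contDiffAt (hg.mem_nhds hξ)).differentiableAt (by simp)

theorem contDiffOn_fderiv (hg : IsPseudoRiemannianOn g U) : ContDiffOn ℝ ∞ (fderiv ℝ g) U :=
  hg.smooth.fderiv_of_isOpen hg.isOpen (by simp)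

theorem christoffel_symm (hg : IsPseudoRiemannianOn g U) {ξ : V} (hξ : ξ ∈ U) (u v : V) :
    christoffel g ξ u v = christoffel g ξ v u := by
  rw [christoffel_apply, christoffel_apply]
  congr 1
  ext w
  exact koszul_symm (hg.fderiv_symm hξ) u v w

variable [FiniteDimensional ℝ V]

theorem metric_christoffel (hg : IsPseudoRiemannianOn g U) {ξ : V} (hξ : ξ ∈ U) (u v w : V) :
    g ξ (christoffel g ξ u v) w = koszul g ξ u v w := by
  rw [christoffel_apply, (hg.pseudoEuclidean ξ hξ).isInvertible.self_apply_inverse]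

/-- Metricity ∇g = 0: adding two Koszul expressions cancels the derivatives in the directions v and
w. -/
theorem fderiv_eq (hg : IsPseudoRiemannianOn g U) {ξ : V} (hξ : ξ ∈ U) (u v w : V) :
    fderiv ℝ g ξ u v w = g ξ (christoffel g ξ u v) w + g ξ v (christoffel g ξ u w) := by
  rw [(hg.pseudoEuclidean ξ hξ).symm v, hg.metric_christoffel hξ, hg.metric_christoffel hξ,
    koszul_apply, koszul_apply, hg.fderiv_symm hξ u w v]
  ring

theorem contDiffOn_christoffel (hg : IsPseudoRiemannianOn g U) :
    ContDiffOn ℝ ∞ (christoffel g) U := by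
  have : CompleteSpace V := FiniteDimensional.complete ℝ V
  have hk : ContDiffOn ℝ ∞ (koszul g) U := by
    have h1 := hg.contDiffOn_fderiv
    have h2 : ContDiffOn ℝ ∞ (fun ξ => (fderiv ℝ g ξ).flip) U :=
      (ContinuousLinearMap.flipₗᵢ ℝ V V (V →L[ℝ] ℝ)).contDiff.comp_contDiffOn h1
    exact ((h1.add h2).sub (contDiffOn_const.clm_comp h2)).const_smul (1 / 2 : ℝ)
  have hi : ContDiffOn ℝ ∞ (fun ξ => (g ξ).inverse) U := fun ξ hξ =>
    ((hg.pseudoEuclidean ξ hξ).isInvertible.contDiffAt_map_inverse (n := ∞)).comp_contDiffWithinAt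
      ξ (hg.smooth ξ hξ)
  exact ((ContinuousLinearMap.compL ℝ V (V →L[ℝ] ℝ) V).contDiff.comp_contDiffOn hi).clm_comp hk

theorem differentiableAt_christoffel (hg : IsPseudoRiemannianOn g U) {ξ : V} (hξ : ξ ∈ U) :
    DifferentiableAt ℝ (christoffel g) ξ :=
  (hg.contDiffOn_christoffel.contDiffAt (hg.mem_nhds hξ)).differentiableAt (by simp)

theorem contDiffOn_curvatureOp (hg : IsPseudoRiemannianOn g U) :
    ContDiffOn ℝ ∞ (curvatureOp g) U := by
  have h1 := hg.contDiffOn_christoffel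
  have h2 : ContDiffOn ℝ ∞ (fderiv ℝ (christoffel g)) U :=
    h1.fderiv_of_isOpen hg.isOpen (by simp)
  rw [contDiffOn_clm_apply]
  intro x
  rw [contDiffOn_clm_apply]
  intro y
  rw [contDiffOn_clm_apply]
  intro z
  simp only [curvatureOp_apply]
  fun_prop

theorem fderiv_christoffel_symm (hg : IsPseudoRiemannianOn g U) {ξ : V} (hξ : ξ ∈ U)
    (x y z : V) : fderiv ℝ (christoffel g) ξ x y z = fderiv ℝ (christoffel g) ξ x z y := by
  have hd := hg.differentiableAt_christoffel hξ
  have h1 : HasFDerivAt (fun p => (christoffel g p).flip) _ ξ :=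
    (ContinuousLinearMap.flipₗᵢ ℝ V V V).toContinuousLinearEquiv.hasFDerivAt.comp ξ hd.hasFDerivAt
  have h2 : (fun p => (christoffel g p).flip) =ᶠ[𝓝 ξ] christoffel g := by
    filter_upwards [hg.mem_nhds hξ] with p hp
    ext x y
    exact hg.christoffel_symm hp y x
  have h3 := (h1.congr_of_eventuallyEq h2.symm).unique hd.hasFDerivAt
  exact congrArg (fun L : V →L[ℝ] V →L[ℝ] V →L[ℝ] V => L x z y) h3

theorem curvatureOp_bianchi (hg : IsPseudoRiemannianOn g U) {ξ : V} (hξ : ξ ∈ U) (x y z : V) :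
    curvatureOp g ξ x y z + curvatureOp g ξ y z x + curvatureOp g ξ z x y = 0 := by
  simp only [curvatureOp_apply]
  rw [hg.fderiv_christoffel_symm hξ x y z, hg.fderiv_christoffel_symm hξ y z x,
    hg.fderiv_christoffel_symm hξ z x y, hg.christoffel_symm hξ y z, hg.christoffel_symm hξ x z,
    hg.christoffel_symm hξ y x]
  abel

theorem fderiv_fderiv_eq (hg : IsPseudoRiemannianOn g U) {ξ : V} (hξ : ξ ∈ U) (x y z w : V) :
    fderiv ℝ (fderiv ℝ g) ξ x y z w =
      g ξ (christoffel g ξ x (christoffel g ξ y z)) w +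
        g ξ (christoffel g ξ y z) (christoffel g ξ x w) +
        g ξ (fderiv ℝ (christoffel g) ξ x y z) w +
      (g ξ (christoffel g ξ x z) (christoffel g ξ y w) +
        g ξ z (christoffel g ξ x (christoffel g ξ y w)) +
        g ξ z (fderiv ℝ (christoffel g) ξ x y w)) := by
  have hF : DifferentiableAt ℝ (fderiv ℝ g) ξ :=
    (hg.contDiffOn_fderiv.contDiffAt (hg.mem_nhds hξ)).differentiableAt (by simp)
  have hΓ := (hg.differentiableAt_christoffel hξ).hasFDerivAt
  have hG := (hg.differentiableAt hξ).hasFDerivAt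
  have hc : ∀ v : V, HasFDerivAt (fun _ : V => v) (0 : V →L[ℝ] V) ξ := fun v =>
    hasFDerivAt_const v ξ
  have h1 := ((hF.hasFDerivAt.clm_apply (hc y)).clm_apply (hc z)).clm_apply (hc w)
  have h2 := (hG.clm_apply ((hΓ.clm_apply (hc y)).clm_apply (hc z))).clm_apply (hc w)
  have h3 := (hG.clm_apply (hc z)).clm_apply ((hΓ.clm_apply (hc y)).clm_apply (hc w))
  have h4 : (fun p => fderiv ℝ g p y z w) =ᶠ[𝓝 ξ] fun p =>
      g p (christoffel g p y z) w + g p z (christoffel g p y w) := by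
    filter_upwards [hg.mem_nhds hξ] with p hp
    exact hg.fderiv_eq hp y z w
  have h5 := (h1.congr_of_eventuallyEq h4.symm).unique (h2.add h3)
  have h6 := congrArg (fun L : V →L[ℝ] ℝ => L x) h5
  simp at h6
  rw [h6, hg.fderiv_eq hξ, hg.fderiv_eq hξ]
  ring

/-- Second derivatives of g commute. Differentiating metricity and antisymmetrizing in x, y cancels
the mixed Γ-terms and leaves the two curvature terms. -/
theorem metric_curvatureOp_antisymm (hg : IsPseudoRiemannianOn g U) {ξ : V} (hξ : ξ ∈ U)
    (x y z w : V) : g ξ (curvatureOp g ξ x y z) w = -g ξ (curvatureOp g ξ x y w) z := by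
  have hs : IsSymmSndFDerivAt ℝ g ξ :=
    (hg.smooth.contDiffAt (hg.mem_nhds hξ)).isSymmSndFDerivAt
      (by simpa using (WithTop.coe_le_coe.2 le_top : ((2 : ℕ∞) : WithTop ℕ∞) ≤ ∞))
  have h := congrArg (fun L : V →L[ℝ] V →L[ℝ] ℝ => L z w) (hs x y)
  simp only [hg.fderiv_fderiv_eq hξ] at h
  rw [(hg.pseudoEuclidean ξ hξ).symm _ z, curvatureOp_apply, curvatureOp_apply]
  simp only [map_add, map_sub, _root_.add_apply, _root_.sub_apply]
  linarith

/-- The first Bianchi identity paired with v, combined with both skew symmetries. -/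
theorem jacobi_symm (hg : IsPseudoRiemannianOn g U) {ξ : V} (hξ : ξ ∈ U) (v x y : V) :
    g ξ (curvatureOp g ξ x v v) y = g ξ (curvatureOp g ξ y v v) x := by
  have h1 := hg.metric_curvatureOp_antisymm hξ x v v y
  have h2 := hg.metric_curvatureOp_antisymm hξ y v v x
  have h3 := congrArg (fun u => g ξ u v) (hg.curvatureOp_bianchi hξ x v y)
  have h4 := hg.metric_curvatureOp_antisymm hξ y x v v
  have h5 := curvatureOp_swap g ξ v y x
  simp only [map_add, _root_.add_apply, map_zero, _root_.zero_apply, h5, map_neg,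
    _root_.neg_apply] at h3
  linarith

end IsPseudoRiemannianOn

/-! ### Smoothness of the iterated covariant derivatives -/

/-- In finite dimension, smoothness into a space of linear maps can be tested on fixed vectors;
currying treats one slot at a time. -/
theorem contDiffOn_multilinear_apply [FiniteDimensional ℝ V] {m : ℕ} {f : V → V [×m]→L[ℝ] ℝ}
    {U : Set V} (h : ∀ v : Fin m → V, ContDiffOn ℝ ∞ (fun ξ => f ξ v) U) :
    ContDiffOn ℝ ∞ f U := by
  induction m with
  | zero =>
    rw [← (continuousMultilinearCurryFin0 ℝ V ℝ).toContinuousLinearEquiv.comp_contDiffOn_iff]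
    exact h _
  | succ m ih =>
    rw [← (continuousMultilinearCurryLeftEquiv ℝ (fun _ : Fin (m + 1) => V)
      ℝ).toContinuousLinearEquiv.comp_contDiffOn_iff, contDiffOn_clm_apply]
    intro x
    exact ih fun v => h (Fin.cons x v)

theorem contDiffOn_covDeriv {Γ : V → V →L[ℝ] V →L[ℝ] V} {U : Set V} (hU : IsOpen U)
    (hΓ : ContDiffOn ℝ ∞ Γ U) {m : ℕ} {T : V → V [×m]→L[ℝ] ℝ} (hT : ContDiffOn ℝ ∞ T U) :
    ContDiffOn ℝ ∞ (covDeriv Γ T) U := by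
  have h1 : ContDiffOn ℝ ∞ (fderiv ℝ T) U := hT.fderiv_of_isOpen hU (by simp)
  have h2 : ContDiffOn ℝ ∞ (fun ξ => (derivation (V := V) m).flip (T ξ)) U :=
    (derivation (V := V) m).flip.contDiff.comp_contDiffOn hT
  exact (continuousMultilinearCurryLeftEquiv ℝ (fun _ : Fin (m + 1) => V)
    ℝ).symm.contDiff.comp_contDiffOn (h1.sub (h2.clm_comp hΓ))

theorem contDiffOn_iterCovDeriv {Γ : V → V →L[ℝ] V →L[ℝ] V} {U : Set V} (hU : IsOpen U)
    (hΓ : ContDiffOn ℝ ∞ Γ U) {m : ℕ} {T : V → V [×m]→L[ℝ] ℝ} (hT : ContDiffOn ℝ ∞ T U) (k : ℕ) :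
    ContDiffOn ℝ ∞ (iterCovDeriv Γ T k) U := by
  induction k with
  | zero => exact hT
  | succ k ih => exact contDiffOn_covDeriv hU hΓ ih

theorem IsPseudoRiemannianOn.contDiffOn_curvature [FiniteDimensional ℝ V]
    {g : V → V →L[ℝ] V →L[ℝ] ℝ} {U : Set V} (hg : IsPseudoRiemannianOn g U) :
    ContDiffOn ℝ ∞ (curvature g) U := by
  refine contDiffOn_multilinear_apply fun v => ?_
  have h1 := hg.contDiffOn_curvatureOp
  have h2 := hg.smooth
  exact (h2.clm_apply (((h1.clm_apply contDiffOn_const).clm_apply contDiffOn_const).clm_apply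
    contDiffOn_const)).clm_apply contDiffOn_const

end Riemannian

/-! ### Covariant differentiation along a curve -/

section CurveDeriv

variable {E F H : Type*} [NormedAddCommGroup E] [NormedSpace ℝ E] [NormedAddCommGroup F]
  [NormedSpace ℝ F] [NormedAddCommGroup H] [NormedSpace ℝ H]

/-- The covariant derivative `u' + C u` of a curve `u` with respect to the connection form `C`. -/
def curveDeriv (C : ℝ → E →L[ℝ] E) (u : ℝ → E) (t : ℝ) : E := deriv u t + C t (u t)

variable {s : Set ℝ}

theorem contDiffOn_curveDeriv (hs : IsOpen s) {C : ℝ → E →L[ℝ] E} (hC : ContDiffOn ℝ ∞ C s)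
    {u : ℝ → E} (hu : ContDiffOn ℝ ∞ u s) : ContDiffOn ℝ ∞ (curveDeriv C u) s :=
  (hu.deriv_of_isOpen hs (by simp)).add (hC.clm_apply hu)

theorem contDiffOn_iterate_curveDeriv (hs : IsOpen s) {C : ℝ → E →L[ℝ] E}
    (hC : ContDiffOn ℝ ∞ C s) {u : ℝ → E} (hu : ContDiffOn ℝ ∞ u s) (n : ℕ) :
    ContDiffOn ℝ ∞ ((curveDeriv C)^[n] u) s := by
  induction n with
  | zero => exact hu
  | succ n ih =>
    rw [Function.iterate_succ_apply']
    exact contDiffOn_curveDeriv hs hC ih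

theorem hasDerivAt_of_contDiffOn (hs : IsOpen s) {u : ℝ → E} (hu : ContDiffOn ℝ ∞ u s) {t : ℝ}
    (ht : t ∈ s) : HasDerivAt u (deriv u t) t :=
  ((hu.contDiffAt (hs.mem_nhds ht)).differentiableAt (by simp)).hasDerivAt

theorem curveDeriv_congr (hs : IsOpen s) (C : ℝ → E →L[ℝ] E) {u v : ℝ → E} (h : Set.EqOn u v s) :
    Set.EqOn (curveDeriv C u) (curveDeriv C v) s := fun t ht => by
  rw [curveDeriv, curveDeriv, h ht,
    Filter.EventuallyEq.deriv_eq (Filter.eventuallyEq_of_mem (hs.mem_nhds ht) h)]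

theorem iterate_curveDeriv_congr (hs : IsOpen s) (C : ℝ → E →L[ℝ] E) {u v : ℝ → E}
    (h : Set.EqOn u v s) (n : ℕ) :
    Set.EqOn ((curveDeriv C)^[n] u) ((curveDeriv C)^[n] v) s := by
  induction n with
  | zero => exact h
  | succ n ih =>
    rw [Function.iterate_succ_apply', Function.iterate_succ_apply']
    exact curveDeriv_congr hs C ih

/-- Leibniz' rule for the iterated covariant derivative of a parallel bilinear pairing. -/
theorem iterate_curveDeriv_bilinear (hs : IsOpen s) {B : ℝ → E →L[ℝ] F →L[ℝ] H}
    (hB : ContDiffOn ℝ ∞ B s) {C₁ : ℝ → E →L[ℝ] E} (hC₁ : ContDiffOn ℝ ∞ C₁ s)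
    {C₂ : ℝ → F →L[ℝ] F} (hC₂ : ContDiffOn ℝ ∞ C₂ s) {C₃ : ℝ → H →L[ℝ] H}
    (hpar : ∀ t ∈ s, ∀ e f,
      deriv B t e f + C₃ t (B t e f) = B t (C₁ t e) f + B t e (C₂ t f))
    {u : ℝ → E} (hu : ContDiffOn ℝ ∞ u s) {v : ℝ → F} (hv : ContDiffOn ℝ ∞ v s) (n : ℕ) {t : ℝ}
    (ht : t ∈ s) :
    (curveDeriv C₃)^[n] (fun t => B t (u t) (v t)) t =
      ∑ p ∈ Finset.HasAntidiagonal.antidiagonal n,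
        n.choose p.1 • B t ((curveDeriv C₁)^[p.1] u t) ((curveDeriv C₂)^[p.2] v t) := by
  induction n generalizing t with
  | zero => simp
  | succ n ih =>
    rw [Function.iterate_succ_apply', curveDeriv_congr hs C₃ (fun t ht => ih ht) ht, curveDeriv,
      Finset.sum_antidiagonal_choose_succ_nsmul (fun i j => B t ((curveDeriv C₁)^[i] u t)
        ((curveDeriv C₂)^[j] v t)) n]
    have hd : ∀ p : ℕ × ℕ, HasDerivAt
        (fun t => n.choose p.1 • B t ((curveDeriv C₁)^[p.1] u t) ((curveDeriv C₂)^[p.2] v t))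
        (n.choose p.1 • ((deriv B t ((curveDeriv C₁)^[p.1] u t) +
          B t (deriv ((curveDeriv C₁)^[p.1] u) t)) ((curveDeriv C₂)^[p.2] v t) +
          B t ((curveDeriv C₁)^[p.1] u t) (deriv ((curveDeriv C₂)^[p.2] v) t))) t := by
      intro p
      have hu' := hasDerivAt_of_contDiffOn hs (contDiffOn_iterate_curveDeriv hs hC₁ hu p.1) ht
      have hv' := hasDerivAt_of_contDiffOn hs (contDiffOn_iterate_curveDeriv hs hC₂ hv p.2) ht
      exact (((hasDerivAt_of_contDiffOn hs hB ht).clm_apply hu').clm_apply hv').const_smul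
        (n.choose p.1)
    rw [(HasDerivAt.fun_sum fun p _ => hd p).deriv, map_sum, ← Finset.sum_add_distrib,
      ← Finset.sum_add_distrib]
    refine Finset.sum_congr rfl fun p hp => ?_
    have hp := Finset.HasAntidiagonal.mem_antidiagonal.1 hp
    rw [show n.choose p.2 = n.choose p.1 by rw [← hp, Nat.choose_symm_add], map_nsmul,
      ← smul_add, ← smul_add, Function.iterate_succ_apply', Function.iterate_succ_apply',
      curveDeriv, curveDeriv]
    congr 1
    -- Parallelism trades the derivative of B for connection terms, completing both derivatives to
    -- covariant ones.
    have := eq_sub_of_add_eq (hpar t ht ((curveDeriv C₁)^[p.1] u t) ((curveDeriv C₂)^[p.2] v t))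
    simp only [map_add, _root_.add_apply]
    rw [this]
    abel

theorem curveDeriv_zero : curveDeriv (0 : ℝ → E →L[ℝ] E) = deriv := by
  funext u t
  simp [curveDeriv]

theorem iterate_deriv_id_smul (hs : IsOpen s) {u : ℝ → E} (hu : ContDiffOn ℝ ∞ u s) (n : ℕ)
    {t : ℝ} (ht : t ∈ s) :
    deriv^[n + 1] (fun t => t • u t) t = t • deriv^[n + 1] u t + ((n : ℝ) + 1) • deriv^[n] u t := by
  have hn : ∀ k, ContDiffOn ℝ ∞ (deriv^[k] u) s := fun k => by
    simpa only [curveDeriv_zero] using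
      contDiffOn_iterate_curveDeriv hs (C := 0) contDiffOn_const hu k
  have hd : ∀ k, ∀ t ∈ s, HasDerivAt (fun t => t • deriv^[k] u t)
      (t • deriv^[k + 1] u t + deriv^[k] u t) t := fun k t ht => by
    rw [Function.iterate_succ_apply']
    have := (hasDerivAt_id t).smul (hasDerivAt_of_contDiffOn hs (hn k) ht)
    rw [one_smul] at this
    exact this
  induction n generalizing t with
  | zero => simpa using (hd 0 t ht).deriv
  | succ n ih =>
    rw [Function.iterate_succ_apply',
      Filter.EventuallyEq.deriv_eq (Filter.eventuallyEq_of_mem (hs.mem_nhds ht) fun t ht => ih ht)]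
    have h1 := (hd (n + 1) t ht).add
      ((hasDerivAt_of_contDiffOn hs (hn n) ht).const_smul ((n : ℝ) + 1))
    refine h1.deriv.trans ?_
    rw [← Function.iterate_succ_apply' deriv]
    push_cast
    module

/-- At t = 0 only the terms in which both factors t have been differentiated survive. -/
theorem iterate_deriv_sq_smul_zero (hs : IsOpen s) (h0 : (0 : ℝ) ∈ s) {u : ℝ → E}
    (hu : ContDiffOn ℝ ∞ u s) (n : ℕ) :
    deriv^[n + 2] (fun t => t • t • u t) 0 = (((n : ℝ) + 2) * ((n : ℝ) + 1)) • deriv^[n] u 0 := by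
  have hu' : ContDiffOn ℝ ∞ (fun t : ℝ => t • u t) s := contDiffOn_id.smul hu
  rw [iterate_deriv_id_smul hs hu' (n + 1) h0, iterate_deriv_id_smul hs hu n h0]
  push_cast
  module

end CurveDeriv

/-! ### The Jacobi equation along the radial geodesics -/

theorem jacobiArgs_succ {V : Type*} (k : ℕ) (ξ x y : V) :
    jacobiArgs (k + 1) ξ x y =
      (Fin.cons ξ (jacobiArgs k ξ x y) : Fin (4 + k + 1) → V) := by
  funext i
  refine Fin.cases ?_ (fun i => ?_) i
  · simp [jacobiArgs, Fin.ext_iff]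
  · simp [jacobiArgs, Function.update_apply, Fin.ext_iff, add_right_comm k 1 3]

section Radial

variable {V : Type*} [NormedAddCommGroup V] [NormedSpace ℝ V]

/-- The connection form of the Levi-Civita connection along the ray through `ξ`. -/
def rayConnection (g : V → V →L[ℝ] V →L[ℝ] ℝ) (ξ : V) (t : ℝ) : V →L[ℝ] V :=
  christoffel g (t • ξ) ξ

/-- The adjoint action `A ↦ [A, ·]` of the endomorphisms on themselves. -/
def commutatorCLM (V : Type*) [NormedAddCommGroup V] [NormedSpace ℝ V] :
    (V →L[ℝ] V) →L[ℝ] (V →L[ℝ] V) →L[ℝ] (V →L[ℝ] V) :=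
  ContinuousLinearMap.compL ℝ V V V - (ContinuousLinearMap.compL ℝ V V V).flip

/-- The induced connection form on endomorphisms. -/
def rayConnectionEnd (g : V → V →L[ℝ] V →L[ℝ] ℝ) (ξ : V) (t : ℝ) :
    (V →L[ℝ] V) →L[ℝ] (V →L[ℝ] V) :=
  commutatorCLM V (rayConnection g ξ t)

theorem rayConnectionEnd_apply (g : V → V →L[ℝ] V →L[ℝ] ℝ) (ξ : V) (t : ℝ) (S : V →L[ℝ] V)
    (x : V) : rayConnectionEnd g ξ t S x = rayConnection g ξ t (S x) - S (rayConnection g ξ t x) :=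
  rfl

/-- The Jacobi operator `x ↦ R(x, ξ)ξ` along the ray through `ξ`. -/
def rayJacobi (g : V → V →L[ℝ] V →L[ℝ] ℝ) (ξ : V) (t : ℝ) : V →L[ℝ] V :=
  ((curvatureOp g (t • ξ)).flip ξ).flip ξ

theorem rayJacobi_apply (g : V → V →L[ℝ] V →L[ℝ] ℝ) (ξ : V) (t : ℝ) (x : V) :
    rayJacobi g ξ t x = curvatureOp g (t • ξ) x ξ ξ := rfl

/-- The iterated covariant derivatives of the Jacobi operator along the ray through `ξ`. -/
def rayJacobiDeriv (g : V → V →L[ℝ] V →L[ℝ] ℝ) (ξ : V) (m : ℕ) : ℝ → V →L[ℝ] V :=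
  (curveDeriv (rayConnectionEnd g ξ))^[m] (rayJacobi g ξ)

theorem isOpen_ray {U : Set V} (hU : IsOpen U) (ξ : V) : IsOpen {t : ℝ | t • ξ ∈ U} :=
  hU.preimage (by fun_prop)

theorem contDiffOn_ray {W : Type*} [NormedAddCommGroup W] [NormedSpace ℝ W] {f : V → W} {U : Set V}
    (hf : ContDiffOn ℝ ∞ f U) (ξ : V) :
    ContDiffOn ℝ ∞ (fun t : ℝ => f (t • ξ)) {t : ℝ | t • ξ ∈ U} :=
  hf.comp (by fun_prop) fun _ ht => ht

theorem hasDerivAt_ray {W : Type*} [NormedAddCommGroup W] [NormedSpace ℝ W] {f : V → W} {ξ : V}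
    {t : ℝ} (hf : DifferentiableAt ℝ f (t • ξ)) :
    HasDerivAt (fun t : ℝ => f (t • ξ)) (fderiv ℝ f (t • ξ) ξ) t := by
  have h := hf.hasFDerivAt.comp_hasDerivAt t ((hasDerivAt_id t).smul_const ξ)
  rw [one_smul] at h
  exact h

variable {g : V → V →L[ℝ] V →L[ℝ] ℝ} {U : Set V} [FiniteDimensional ℝ V]

namespace IsPseudoRiemannianOn

theorem contDiffOn_rayConnection (hg : IsPseudoRiemannianOn g U) (ξ : V) :
    ContDiffOn ℝ ∞ (rayConnection g ξ) {t : ℝ | t • ξ ∈ U} :=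
  (contDiffOn_ray hg.contDiffOn_christoffel ξ).clm_apply contDiffOn_const

theorem contDiffOn_rayConnectionEnd (hg : IsPseudoRiemannianOn g U) (ξ : V) :
    ContDiffOn ℝ ∞ (rayConnectionEnd g ξ) {t : ℝ | t • ξ ∈ U} :=
  (hg.contDiffOn_rayConnection ξ).continuousLinearMap_comp (commutatorCLM V)

theorem contDiffOn_rayJacobi (hg : IsPseudoRiemannianOn g U) (ξ : V) :
    ContDiffOn ℝ ∞ (rayJacobi g ξ) {t : ℝ | t • ξ ∈ U} := by
  rw [contDiffOn_clm_apply]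
  intro x
  simp only [rayJacobi_apply]
  have h := contDiffOn_ray hg.contDiffOn_curvatureOp ξ
  fun_prop

theorem contDiffOn_rayJacobiDeriv (hg : IsPseudoRiemannianOn g U) (ξ : V) (m : ℕ) :
    ContDiffOn ℝ ∞ (rayJacobiDeriv g ξ m) {t : ℝ | t • ξ ∈ U} :=
  contDiffOn_iterate_curveDeriv (isOpen_ray hg.isOpen ξ) (hg.contDiffOn_rayConnectionEnd ξ)
    (hg.contDiffOn_rayJacobi ξ) m

theorem deriv_ray_metric (hg : IsPseudoRiemannianOn g U) {ξ : V} {t : ℝ} (ht : t • ξ ∈ U)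
    (x y : V) :
    deriv (fun t : ℝ => g (t • ξ)) t x y =
      g (t • ξ) (rayConnection g ξ t x) y + g (t • ξ) x (rayConnection g ξ t y) := by
  rw [(hasDerivAt_ray (hg.differentiableAt ht)).deriv, hg.fderiv_eq ht]
  rfl

/-- The product rule with metricity; the commutator in the induced connection cancels the term in
which the connection acts after the operator. -/
theorem hasDerivAt_metric_rayJacobiDeriv (hg : IsPseudoRiemannianOn g U) {ξ : V} {t : ℝ}
    (ht : t • ξ ∈ U) (m : ℕ) (x y : V) :
    HasDerivAt (fun t : ℝ => g (t • ξ) (rayJacobiDeriv g ξ m t x) y)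
      (g (t • ξ) (rayJacobiDeriv g ξ (m + 1) t x) y +
        g (t • ξ) (rayJacobiDeriv g ξ m t (rayConnection g ξ t x)) y +
        g (t • ξ) (rayJacobiDeriv g ξ m t x) (rayConnection g ξ t y)) t := by
  have hs := isOpen_ray hg.isOpen ξ
  have h1 := hasDerivAt_of_contDiffOn hs (hg.contDiffOn_rayJacobiDeriv ξ m) ht
  have h2 := hasDerivAt_of_contDiffOn hs (contDiffOn_ray hg.smooth ξ) ht
  have h3 := (h2.clm_apply (h1.clm_apply (hasDerivAt_const t x))).clm_apply (hasDerivAt_const t y)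
  refine h3.congr_deriv ?_
  have h4 : rayJacobiDeriv g ξ (m + 1) t = deriv (rayJacobiDeriv g ξ m) t +
      rayConnectionEnd g ξ t (rayJacobiDeriv g ξ m t) := by
    rw [rayJacobiDeriv, Function.iterate_succ_apply']
    rfl
  simp only [map_zero, add_zero, _root_.add_apply, hg.deriv_ray_metric ht, h4,
    rayConnectionEnd_apply, map_add, map_sub, _root_.sub_apply]
  ring

/-- Differentiating the symmetry of order m along the ray: the connection terms match by induction,
and what remains is order m + 1. -/
theorem rayJacobiDeriv_symm (hg : IsPseudoRiemannianOn g U) {ξ : V} {t : ℝ} (ht : t • ξ ∈ U)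
    (m : ℕ) (x y : V) :
    g (t • ξ) (rayJacobiDeriv g ξ m t x) y = g (t • ξ) (rayJacobiDeriv g ξ m t y) x := by
  induction m generalizing t x y with
  | zero => exact hg.jacobi_symm ht ξ x y
  | succ m ih =>
    have h1 := hg.hasDerivAt_metric_rayJacobiDeriv ht m x y
    have h2 := hg.hasDerivAt_metric_rayJacobiDeriv ht m y x
    have h3 := (h1.congr_of_eventuallyEq (Filter.eventuallyEq_of_mem
      ((isOpen_ray hg.isOpen ξ).mem_nhds ht) fun t ht => ih ht y x)).unique h2
    rw [ih ht x (rayConnection g ξ t y), ih ht y (rayConnection g ξ t x)] at h3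
    linarith

end IsPseudoRiemannianOn

end Radial

/-! ### Normal coordinates: Jacobi fields and radial derivatives of the metric -/

section Core

variable {V : Type*} [NormedAddCommGroup V] [NormedSpace ℝ V]
  {g : V → V →L[ℝ] V →L[ℝ] ℝ} {U : Set V}

theorem deriv_smul_const_fun (ξ : V) : deriv (fun t : ℝ => t • ξ) = fun _ => ξ := by
  funext t
  simpa using ((hasDerivAt_id t).smul_const ξ).deriv

theorem curveDeriv_smul_const (ξ y : V) (t : ℝ) :
    curveDeriv (rayConnection g ξ) (fun t : ℝ => t • y) t = y + t • rayConnection g ξ t y := by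
  rw [curveDeriv, deriv_smul_const_fun, map_smul]

theorem IsNormalMetricOn.christoffel_self (hg : IsNormalMetricOn g U) {x : V} (hx : x ∈ U) :
    christoffel g x x x = 0 := by
  have h := (hg.geodesic x hx 1 (by simp)).2
  simp only [deriv_smul_const_fun, one_smul] at h
  have := h.unique (hasDerivAt_const (1 : ℝ) x)
  rwa [neg_eq_zero] at this

namespace IsPseudoRiemannianOn

variable [FiniteDimensional ℝ V]

/-- For t ≠ 0 the factor t² can be divided out of Γ_{tξ}(tξ, tξ) = 0; t = 0 follows by continuity.
-/
theorem rayConnection_self (hg : IsPseudoRiemannianOn g U) (hΓ : ∀ x ∈ U, christoffel g x x x = 0)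
    {ξ : V} {t : ℝ} (ht : t • ξ ∈ U) : rayConnection g ξ t ξ = 0 := by
  have hs := isOpen_ray hg.isOpen ξ
  have hne : ∀ r : ℝ, r ≠ 0 → r • ξ ∈ U → rayConnection g ξ r ξ = 0 := by
    intro r hr hrU
    have := hΓ _ hrU
    simp only [map_smul, _root_.smul_apply, smul_eq_zero, hr, false_or] at this
    exact this
  rcases eq_or_ne t 0 with rfl | h
  · have hc : Tendsto (fun r : ℝ => rayConnection g ξ r ξ) (𝓝[≠] 0)
        (𝓝 (rayConnection g ξ 0 ξ)) :=
      ((((hg.contDiffOn_rayConnection ξ).clm_apply contDiffOn_const).continuousOn.continuousAt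
        (hs.mem_nhds ht)).tendsto).mono_left nhdsWithin_le_nhds
    have hz : (fun r : ℝ => rayConnection g ξ r ξ) =ᶠ[𝓝[≠] 0] fun _ => 0 := by
      filter_upwards [self_mem_nhdsWithin, mem_nhdsWithin_of_mem_nhds (hs.mem_nhds ht)]
        with r hr hrU
      exact hne r hr hrU
    exact tendsto_nhds_unique hc (tendsto_const_nhds.congr' hz.symm)
  · exact hne t h ht

theorem christoffel_zero (hg : IsPseudoRiemannianOn g U) (h0 : (0 : V) ∈ U)
    (hΓ : ∀ x ∈ U, christoffel g x x x = 0) (u v : V) : christoffel g 0 u v = 0 := by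
  have h : ∀ w, christoffel g 0 w w = 0 := fun w => by
    simpa [rayConnection] using hg.rayConnection_self hΓ (ξ := w) (t := 0) (by simpa using h0)
  have h1 := h (u + v)
  simp only [map_add, _root_.add_apply, h, zero_add, add_zero, hg.christoffel_symm h0 v u] at h1
  have h2 : (2 : ℝ) • christoffel g 0 u v = 0 := by rw [two_smul, h1]
  exact (smul_eq_zero.1 h2).resolve_left two_ne_zero

/-- Differentiate Γ_x(x, x) = 0 at x = tξ in the direction y and cancel one factor t; at t = 0 use
Γ_0 = 0. -/
theorem smul_fderiv_christoffel (hg : IsPseudoRiemannianOn g U) (h0 : (0 : V) ∈ U)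
    (hΓ : ∀ x ∈ U, christoffel g x x x = 0) {ξ : V} {t : ℝ} (ht : t • ξ ∈ U) (y : V) :
    t • fderiv ℝ (christoffel g) (t • ξ) y ξ ξ = -((2 : ℝ) • rayConnection g ξ t y) := by
  rcases eq_or_ne t 0 with rfl | hne
  · rw [rayConnection, zero_smul ℝ ξ, hg.christoffel_zero h0 hΓ]
    simp
  have h1 := (((hg.differentiableAt_christoffel ht).hasFDerivAt.clm_apply
    (hasFDerivAt_id (t • ξ))).clm_apply (hasFDerivAt_id (t • ξ)))
  have h2 : (fun x => christoffel g x x x) =ᶠ[𝓝 (t • ξ)] fun _ => 0 := by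
    filter_upwards [hg.mem_nhds ht] with x hx using hΓ x hx
  have h3 := h1.unique ((hasFDerivAt_const (0 : V) (t • ξ)).congr_of_eventuallyEq h2)
  have h4 := congrArg (fun L : V →L[ℝ] V => L y) h3
  simp at h4
  rw [hg.christoffel_symm ht y ξ, ← smul_add, ← smul_add, smul_eq_zero] at h4
  have h5 := h4.resolve_left hne
  rw [rayConnection, two_smul, eq_neg_iff_add_eq_zero, ← h5]
  abel

/-- The Jacobi equation: `t ↦ t y` is a Jacobi field along `t ↦ t ξ`. -/
theorem jacobi_equation (hg : IsPseudoRiemannianOn g U) (h0 : (0 : V) ∈ U)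
    (hΓ : ∀ x ∈ U, christoffel g x x x = 0) {ξ : V} {t : ℝ} (ht : t • ξ ∈ U) (y : V) :
    (curveDeriv (rayConnection g ξ))^[2] (fun t : ℝ => t • y) t = -rayJacobi g ξ t (t • y) := by
  have hs := isOpen_ray hg.isOpen ξ
  have h1 : (curveDeriv (rayConnection g ξ)) (fun t : ℝ => t • y) =
      fun t => y + t • rayConnection g ξ t y := funext fun t => curveDeriv_smul_const ξ y t
  have hA : HasDerivAt (fun t => rayConnection g ξ t y)
      (fderiv ℝ (christoffel g) (t • ξ) ξ ξ y) t := by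
    have := ((hasDerivAt_ray (hg.differentiableAt_christoffel ht)).clm_apply
      (hasDerivAt_const t ξ)).clm_apply (hasDerivAt_const t y)
    simp only [map_zero, add_zero] at this
    exact this
  have h2 := ((hasDerivAt_id t).smul hA).const_add y
  have h3 : deriv (fun t => y + t • rayConnection g ξ t y) t =
      t • fderiv ℝ (christoffel g) (t • ξ) ξ ξ y + rayConnection g ξ t y := by
    simpa using h2.deriv
  -- This term of t R(y, ξ)ξ accounts for the two copies of Γ(ξ, y) produced by D²(t y).
  have h4 := hg.smul_fderiv_christoffel h0 hΓ ht y
  have h5 : christoffel g (t • ξ) ξ ξ = 0 := hg.rayConnection_self hΓ ht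
  rw [Function.iterate_succ_apply, h1, Function.iterate_one, curveDeriv, h3, rayJacobi_apply,
    map_smul, _root_.smul_apply, _root_.smul_apply, curvatureOp_apply, h5, map_zero, add_zero,
    hg.fderiv_christoffel_symm ht ξ y ξ, hg.christoffel_symm ht y ξ, smul_sub, h4, map_add,
    map_smul]
  simp only [rayConnection]
  module

/-- Because Γ(ξ, ξ) = 0 along the ray, slots filled with ξ contribute no connection terms to ∇; only
those holding x and y do, exactly as for the Jacobi operator. -/
theorem metric_rayJacobiDeriv (hg : IsPseudoRiemannianOn g U)
    (hΓ : ∀ x ∈ U, christoffel g x x x = 0) {ξ : V} {t : ℝ} (ht : t • ξ ∈ U) (m : ℕ) (x y : V) :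
    g (t • ξ) (rayJacobiDeriv g ξ m t x) y =
      iterCovDeriv (christoffel g) (curvature g) m (t • ξ) (jacobiArgs m ξ x y) := by
  induction m generalizing t x y with
  | zero =>
    change _ = g (t • ξ) (curvatureOp g (t • ξ) (jacobiArgs 0 ξ x y 0) (jacobiArgs 0 ξ x y 1)
      (jacobiArgs 0 ξ x y 2)) (jacobiArgs 0 ξ x y 3)
    simp [jacobiArgs, Fin.ext_iff, rayJacobiDeriv, rayJacobi_apply]
  | succ m ih =>
    have hT : DifferentiableAt ℝ (iterCovDeriv (christoffel g) (curvature g) m) (t • ξ) :=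
      ((contDiffOn_iterCovDeriv hg.isOpen hg.contDiffOn_christoffel hg.contDiffOn_curvature
        m).contDiffAt (hg.mem_nhds ht)).differentiableAt (by simp)
    have h1 : HasDerivAt (fun t : ℝ => iterCovDeriv (christoffel g) (curvature g) m (t • ξ)
        (jacobiArgs m ξ x y))
        (fderiv ℝ (iterCovDeriv (christoffel g) (curvature g) m) (t • ξ) ξ (jacobiArgs m ξ x y)) t :=
      (ContinuousMultilinearMap.apply ℝ (fun _ : Fin (4 + m) => V) ℝ
        (jacobiArgs m ξ x y)).hasFDerivAt.comp_hasDerivAt t (hasDerivAt_ray hT)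
    have h2 := (hg.hasDerivAt_metric_rayJacobiDeriv ht m x y).congr_of_eventuallyEq
      (Filter.eventuallyEq_of_mem ((isOpen_ray hg.isOpen ξ).mem_nhds ht)
        fun t ht => (ih ht x y).symm)
    have h3 := h1.unique h2
    have h5 : christoffel g (t • ξ) ξ ξ = 0 := hg.rayConnection_self hΓ ht
    have hsum : ∑ i, iterCovDeriv (christoffel g) (curvature g) m (t • ξ)
        (Function.update (jacobiArgs m ξ x y) i
          (christoffel g (t • ξ) ξ (jacobiArgs m ξ x y i))) =
        g (t • ξ) (rayJacobiDeriv g ξ m t (rayConnection g ξ t x)) y +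
        g (t • ξ) (rayJacobiDeriv g ξ m t x) (rayConnection g ξ t y) := by
      rw [Fintype.sum_eq_add (⟨m, by omega⟩ : Fin (4 + m)) ⟨m + 3, by omega⟩ (by simp),
        ih ht, ih ht]
      · congr 2
        · rw [jacobiArgs_swap, jacobiArgs_swap, Function.update_idem, Function.update_self]
          rfl
        · rw [jacobiArgs, jacobiArgs, Function.update_idem, Function.update_self]
          rfl
      · rintro i ⟨hi1, hi2⟩
        refine ContinuousMultilinearMap.map_coord_zero _ i ?_
        rw [Function.update_self, jacobiArgs, Function.update_of_ne hi2, Function.update_of_ne hi1,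
          h5]
    rw [jacobiArgs_succ]
    refine Eq.trans ?_ (covDeriv_apply _ _ _ _ _).symm
    refine Eq.trans ?_ (congrArg₂ (fun a b : ℝ => a - b) h3 hsum).symm
    ring

theorem toEnd_symCurvature (hg : IsPseudoRiemannianOn g U) (h0 : (0 : V) ∈ U)
    (hΓ : ∀ x ∈ U, christoffel g x x x = 0) (ξ : V) (m : ℕ) :
    toEnd (g 0) (symCurvature g m ξ) = rayJacobiDeriv g ξ m 0 := by
  have h0' : (0 : ℝ) • ξ ∈ U := by simpa using h0
  have h : symCurvature g m ξ = (g 0).comp (rayJacobiDeriv g ξ m 0) := by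
    ext x y
    have := hg.metric_rayJacobiDeriv hΓ h0' m x y
    rw [zero_smul ℝ ξ] at this
    exact this.symm
  ext x
  rw [toEnd, h]
  exact (hg.pseudoEuclidean 0 h0).isInvertible.inverse_apply_self _

/-- The derivatives at the origin of a metric along the rays, in normal coordinates. -/
theorem iterate_deriv_ray_metric (hg : IsPseudoRiemannianOn g U) (h0 : (0 : V) ∈ U)
    (hΓ : ∀ x ∈ U, christoffel g x x x = 0) (ξ : V) (n : ℕ) (y z : V) :
    deriv^[n] (fun t : ℝ => g (t • ξ) y z) 0 =
      g 0 (evalAt (fun m => toEnd (g 0) (symCurvature g m ξ)) (Q n) y) z := by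
  have hs := isOpen_ray hg.isOpen ξ
  have h0' : (0 : ℝ) • ξ ∈ U := by simpa using h0
  have h0s : (0 : ℝ) ∈ {t : ℝ | t • ξ ∈ U} := h0'
  simp only [hg.toEnd_symCurvature h0 hΓ ξ]
  set x : ℕ → V →L[ℝ] V := fun m => rayJacobiDeriv g ξ m 0 with hx
  have hsym : ∀ j y z, g 0 (x j y) z = g 0 y (x j z) := by
    intro j y z
    have := hg.rayJacobiDeriv_symm h0' j y z
    rw [zero_smul ℝ ξ] at this
    rw [this, (hg.pseudoEuclidean 0 h0).symm]
  have hJ : ∀ y : V, ContDiffOn ℝ ∞ (fun t : ℝ => t • y) {t : ℝ | t • ξ ∈ U} := fun y => by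
    fun_prop
  have hA := hg.contDiffOn_rayConnection ξ
  -- The covariant Taylor coefficients at 0 of the Jacobi field t y.
  let c : V → ℕ → V := fun y n => (curveDeriv (rayConnection g ξ))^[n] (fun t : ℝ => t • y) 0
  have hc0 : ∀ y, c y 0 = 0 := fun y => zero_smul ℝ y
  have hc1 : ∀ y, c y 1 = y := fun y => by
    refine (curveDeriv_smul_const ξ y 0).trans ?_
    rw [zero_smul, add_zero]
  have hcs : ∀ y n, c y (n + 2) =
      -∑ p ∈ Finset.HasAntidiagonal.antidiagonal n, (n.choose p.1 : ℝ) • x p.1 (c y p.2) := by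
    intro y n
    have h1 := iterate_curveDeriv_congr hs (rayConnection g ξ)
      (fun t ht => hg.jacobi_equation h0 hΓ ht y) n h0s
    rw [← Function.iterate_add_apply] at h1
    -- The pairing (S, v) ↦ -S v is parallel for the induced connection on endomorphisms.
    have h2 := iterate_curveDeriv_bilinear hs
      (B := fun _ => -ContinuousLinearMap.id ℝ (V →L[ℝ] V)) contDiffOn_const
      (hg.contDiffOn_rayConnectionEnd ξ) hA (C₃ := rayConnection g ξ)
      (fun t _ e f => by
        simp only [deriv_const, _root_.zero_apply, _root_.neg_apply, ContinuousLinearMap.id_apply,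
          rayConnectionEnd_apply, map_neg]
        abel)
      (hg.contDiffOn_rayJacobi ξ) (hJ y) n h0s
    refine h1.trans (h2.trans ?_)
    rw [← Finset.sum_neg_distrib]
    refine Finset.sum_congr rfl fun p _ => ?_
    rw [Nat.cast_smul_eq_nsmul, ← smul_neg]
    rfl
  have hc : ∀ y n, c y (n + 1) = ((n : ℝ) + 1) • evalAt x (Qtilde n) y := fun y n => by
    rw [jacobi_coeff (hc0 y) (hcs y), hc1]
  -- The metric is a parallel pairing into the flat line, so its covariant derivatives are ordinary
  -- ones.
  have h3 := iterate_curveDeriv_bilinear hs (contDiffOn_ray hg.smooth ξ) hA hA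
    (C₃ := (0 : ℝ → ℝ →L[ℝ] ℝ))
    (fun t ht e f => by
      rw [hg.deriv_ray_metric ht]
      simp)
    (hJ y) (hJ z) (n + 2) h0s
  rw [curveDeriv_zero] at h3
  have h4 : (fun t : ℝ => g (t • ξ) (t • y) (t • z)) = fun t => t • t • g (t • ξ) y z := by
    funext t
    simp
  have hG : ContDiffOn ℝ ∞ (fun t : ℝ => g (t • ξ) y z) {t : ℝ | t • ξ ∈ U} :=
    ((contDiffOn_ray hg.smooth ξ).clm_apply contDiffOn_const).clm_apply contDiffOn_const
  rw [h4, iterate_deriv_sq_smul_zero hs h0s hG] at h3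
  have h5 := jacobi_form_coeff hsym (hc0 y) (hc0 z) (hc y) (hc z) n
  simp only [nsmul_eq_mul, zero_smul ℝ ξ] at h3
  have h6 := h3.trans h5
  rw [smul_eq_mul] at h6
  exact mul_left_cancel₀ (by positivity) h6

end IsPseudoRiemannianOn

end Core

/-! ### Taylor expansion along rays -/

section Taylor

variable {V W : Type*} [NormedAddCommGroup V] [NormedSpace ℝ V] [NormedAddCommGroup W]
  [NormedSpace ℝ W]

theorem norm_iteratedDeriv_ray_le {f : V → W} {U : Set V} (hU : IsOpen U)
    (hf : ContDiffOn ℝ ∞ f U) {ξ : V} {t : ℝ} (ht : t • ξ ∈ U) (n : ℕ) :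
    ‖iteratedDeriv n (fun t : ℝ => f (t • ξ)) t‖ ≤
      ‖iteratedFDerivWithin ℝ n f U (t • ξ)‖ * ‖ξ‖ ^ n := by
  have hs := isOpen_ray hU ξ
  have h := ContinuousLinearMap.iteratedFDerivWithin_comp_right
    (ContinuousLinearMap.toSpanSingleton ℝ ξ) (hf.of_le (m := n) (by exact_mod_cast le_top))
    hU.uniqueDiffOn hs.uniqueDiffOn (x := t) ht (i := n) le_rfl
  rw [← norm_iteratedFDeriv_eq_norm_iteratedDeriv, ← iteratedFDerivWithin_of_isOpen n hs ht]
  refine (congrArg norm h).trans_le ((ContinuousMultilinearMap.norm_compContinuousLinearMap_le _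
    _).trans_eq ?_)
  simp [ContinuousLinearMap.norm_toSpanSingleton]

/-- One-variable Taylor at t = 1 on each segment. The (N+1)-st derivative is bounded near 0 by
continuity, so the remainder is uniform in the direction. -/
theorem isBigO_taylor_ray {f : V → W} {U : Set V} (hU : IsOpen U) (h0 : (0 : V) ∈ U)
    (hf : ContDiffOn ℝ ∞ f U) {p : ℕ → V → W}
    (hp : ∀ n ξ, p n ξ = (1 / (n.factorial : ℝ)) • deriv^[n] (fun t : ℝ => f (t • ξ)) 0) (N : ℕ) :
    (fun ξ => f ξ - ∑ n ∈ Finset.range (N + 1), p n ξ) =O[𝓝 0] fun ξ => ‖ξ‖ ^ (N + 1) := by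
  have hcont : ContinuousAt (iteratedFDerivWithin ℝ (N + 1) f U) 0 :=
    (hf.continuousOn_iteratedFDerivWithin (m := N + 1) (by exact_mod_cast le_top)
      hU.uniqueDiffOn).continuousAt (hU.mem_nhds h0)
  obtain ⟨r, hr, hball⟩ := Metric.eventually_nhds_iff_ball.1
    ((hcont.norm.eventually_lt continuousAt_const (lt_add_one _)).and (hU.mem_nhds h0))
  refine IsBigO.of_bound ((‖iteratedFDerivWithin ℝ (N + 1) f U 0‖ + 1) / (N.factorial : ℝ)) ?_
  filter_upwards [Metric.ball_mem_nhds 0 hr] with ξ hξ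
  have hray : ∀ t ∈ Set.Icc (0 : ℝ) 1, t • ξ ∈ Metric.ball (0 : V) r := by
    intro t ht
    rw [mem_ball_zero_iff] at hξ ⊢
    rw [norm_smul, Real.norm_of_nonneg ht.1]
    exact (mul_le_of_le_one_left (norm_nonneg _) ht.2).trans_lt hξ
  have hs := isOpen_ray hU ξ
  have hφ : ContDiffOn ℝ ∞ (fun t : ℝ => f (t • ξ)) {t : ℝ | t • ξ ∈ U} := contDiffOn_ray hf ξ
  have hsub : Set.Icc (0 : ℝ) 1 ⊆ {t : ℝ | t • ξ ∈ U} := fun t ht => (hball _ (hray t ht)).2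
  have hwithin : ∀ n : ℕ, ∀ t ∈ Set.Icc (0 : ℝ) 1,
      iteratedDerivWithin n (fun t : ℝ => f (t • ξ)) (Set.Icc 0 1) t =
        iteratedDeriv n (fun t : ℝ => f (t • ξ)) t := fun n t ht =>
    iteratedDerivWithin_eq_iteratedDeriv (uniqueDiffOn_Icc zero_lt_one)
      ((hφ.contDiffAt (hs.mem_nhds (hsub ht))).of_le (by exact_mod_cast le_top)) ht
  have key := taylor_mean_remainder_bound (n := N)
    (C := (‖iteratedFDerivWithin ℝ (N + 1) f U 0‖ + 1) * ‖ξ‖ ^ (N + 1)) zero_le_one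
    ((hφ.mono hsub).of_le (by exact_mod_cast le_top)) (Set.right_mem_Icc.2 zero_le_one)
    (fun t ht => by
      rw [hwithin _ t ht]
      refine (norm_iteratedDeriv_ray_le hU hf (hsub ht) (N + 1)).trans ?_
      gcongr
      exact (hball _ (hray t ht)).1.le)
  have hsum : taylorWithinEval (fun t : ℝ => f (t • ξ)) N (Set.Icc 0 1) 0 1 =
      ∑ n ∈ Finset.range (N + 1), p n ξ := by
    rw [taylor_within_apply]
    refine Finset.sum_congr rfl fun n _ => ?_
    rw [hp, hwithin n 0 (Set.left_mem_Icc.2 zero_le_one), iteratedDeriv_eq_iterate]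
    simp
  rw [hsum, one_smul] at key
  refine key.trans_eq ?_
  rw [Real.norm_of_nonneg (by positivity)]
  simp only [sub_zero, one_pow, mul_one]
  ring

theorem iterate_deriv_clm_comp {s : Set ℝ} (hs : IsOpen s) {u : ℝ → V} (hu : ContDiffOn ℝ ∞ u s)
    (L : V →L[ℝ] W) (n : ℕ) {t : ℝ} (ht : t ∈ s) :
    deriv^[n] (fun t => L (u t)) t = L (deriv^[n] u t) := by
  have hn : ∀ k, ContDiffOn ℝ ∞ (deriv^[k] u) s := fun k => by
    simpa only [curveDeriv_zero] using
      contDiffOn_iterate_curveDeriv hs (C := 0) contDiffOn_const hu k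
  induction n generalizing t with
  | zero => rfl
  | succ n ih =>
    rw [Function.iterate_succ_apply', Function.iterate_succ_apply',
      Filter.EventuallyEq.deriv_eq (Filter.eventuallyEq_of_mem (hs.mem_nhds ht) fun t ht => ih ht)]
    exact (L.hasFDerivAt.comp_hasDerivAt t (hasDerivAt_of_contDiffOn hs (hn n) ht)).deriv

end Taylor

/-! ### Metrics in normal coordinates -/

section Expansion

variable {V : Type*} [NormedAddCommGroup V] [NormedSpace ℝ V]

/-- A converse of the Gauss lemma. Differentiating g_p(p, w) = γ(p, w) gives ∂_v g(x, w) = γ(v, w) -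
g_x(v, w), which vanishes if v or w is x; so every Koszul term does. -/
theorem christoffel_self_of_radial {g : V → V →L[ℝ] V →L[ℝ] ℝ} {γ : V →L[ℝ] V →L[ℝ] ℝ} {x : V}
    (hd : DifferentiableAt ℝ g x) (hsymm : ∀ p v w, g p v w = g p w v)
    (hγ : ∀ v w, γ v w = γ w v)
    (hrad : ∀ p w, g p p w = γ p w) : christoffel g x x x = 0 := by
  have h : ∀ v w, fderiv ℝ g x v x w + g x v w = γ v w := by
    intro v w
    have h1 := (hd.hasFDerivAt.clm_apply (hasFDerivAt_id x)).clm_apply (hasFDerivAt_const w x)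
    have h2 := γ.hasFDerivAt.clm_apply (hasFDerivAt_const w x)
    have h3 := (h1.congr_of_eventuallyEq
      (Filter.Eventually.of_forall fun p => (hrad p w).symm)).unique h2
    have h4 := congrArg (fun L : V →L[ℝ] ℝ => L v) h3
    simp at h4
    rw [← h4]
    ring
  have hk : koszul g x x x = 0 := by
    ext w
    rw [koszul_apply]
    have h1 := h x w
    have h2 := h w x
    rw [hrad] at h1
    rw [hsymm x w x, hrad, hγ w x] at h2
    rw [_root_.zero_apply]
    linarith
  rw [christoffel_apply, hk, map_zero]

variable [FiniteDimensional ℝ V]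

theorem IsNormalMetricOn.isBigO_taylorPoly {g : V → V →L[ℝ] V →L[ℝ] ℝ} {U : Set V}
    (hg : IsNormalMetricOn g U) (N : ℕ) :
    (fun ξ => g ξ - taylorPoly (g 0) (symCurvature g) N ξ) =O[𝓝 (0 : V)]
      fun ξ => ‖ξ‖ ^ (N + 1) := by
  refine isBigO_taylor_ray hg.metric.isOpen hg.zero_mem hg.metric.smooth (fun n ξ => ?_) N
  rw [term]
  congr 1
  ext y z
  have hs := isOpen_ray hg.metric.isOpen ξ
  have h0 : (0 : ℝ) • ξ ∈ U := by simpa using hg.zero_mem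
  have h := iterate_deriv_clm_comp hs (contDiffOn_ray hg.metric.smooth ξ)
    ((ContinuousLinearMap.apply ℝ ℝ z).comp (ContinuousLinearMap.apply ℝ (V →L[ℝ] ℝ) y)) n h0
  have h' := hg.metric.iterate_deriv_ray_metric hg.zero_mem (fun x hx => hg.christoffel_self hx)
    ξ n y z
  rw [substitute_apply]
  exact h'.symm.trans h

theorem isNormalMetricOn_ball {g : V → V →L[ℝ] V →L[ℝ] ℝ} {ε : ℝ} (hε : 0 < ε)
    (hg : IsPseudoRiemannianOn g (Metric.ball 0 ε))
    (hΓ : ∀ x ∈ Metric.ball (0 : V) ε, christoffel g x x x = 0) :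
    IsNormalMetricOn g (Metric.ball 0 ε) := by
  have hstar : StarConvex ℝ (0 : V) (Metric.ball 0 ε) :=
    (convex_ball 0 ε).starConvex (Metric.mem_ball_self hε)
  refine ⟨Metric.mem_ball_self hε, hstar, hg, fun ξ hξ t ht => ?_⟩
  have hmem : t • ξ ∈ Metric.ball (0 : V) ε := hstar.smul_mem hξ ht.1 ht.2
  refine ⟨by fun_prop, ?_⟩
  rw [deriv_smul_const_fun]
  have := hg.rayConnection_self hΓ hmem
  rw [rayConnection] at this
  rw [this, neg_zero]
  exact hasDerivAt_const t ξ

end Expansion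

/-! ### The metric with prescribed symmetrized curvature jet -/

theorem iterate_deriv_polynomial_zero (c : ℕ → ℝ) {n N : ℕ} (hn : n < N) :
    deriv^[n] (fun t : ℝ => ∑ i ∈ Finset.range N, t ^ i * c i) 0 = (n.factorial : ℝ) * c n := by
  have hp : (fun t : ℝ => ∑ i ∈ Finset.range N, t ^ i * c i) =
      fun t => (∑ i ∈ Finset.range N, Polynomial.monomial i (c i)).eval t := by
    funext t
    simp [Polynomial.eval_finsetSum, Polynomial.eval_monomial, mul_comm]
  have hd : ∀ (p : Polynomial ℝ) (k : ℕ), deriv^[k] (fun t => p.eval t) =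
      fun t => (Polynomial.derivative^[k] p).eval t := by
    intro p k
    induction k with
    | zero => rfl
    | succ k ih =>
      rw [Function.iterate_succ_apply', Function.iterate_succ_apply', ih]
      funext t
      exact Polynomial.deriv _
  rw [hp, hd]
  beta_reduce
  rw [← Polynomial.coeff_zero_eq_eval_zero, Polynomial.coeff_iterate_derivative]
  simp [Polynomial.coeff_monomial, hn, Nat.descFactorial_self]

section Prescribed

variable {V : Type*} [NormedAddCommGroup V] [NormedSpace ℝ V]

theorem taylorPoly_apply (γ : V →L[ℝ] V →L[ℝ] ℝ) (r : ℕ → V → V →L[ℝ] V →L[ℝ] ℝ) (N : ℕ)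
    (ξ y z : V) :
    taylorPoly γ r N ξ y z = ∑ n ∈ Finset.range (N + 1),
      (1 / (n.factorial : ℝ)) * γ (evalAt (fun l => toEnd γ (r l ξ)) (Q n) y) z := by
  simp only [taylorPoly, term, _root_.sum_apply, _root_.smul_apply, smul_eq_mul,
    substitute_apply]
  rfl

theorem taylorPoly_congr (γ : V →L[ℝ] V →L[ℝ] ℝ) {r r' : ℕ → V → V →L[ℝ] V →L[ℝ] ℝ} {N : ℕ}
    (h : ∀ l, l + 2 ≤ N → r l = r' l) : taylorPoly γ r N = taylorPoly γ r' N := by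
  funext ξ
  refine Finset.sum_congr rfl fun n hn => ?_
  have hn := Finset.mem_range.1 hn
  rw [term, term, substitute_apply, substitute_apply]
  congr 2
  exact evalAt_Q_congr fun l hl => by rw [h l (by omega)]

theorem contDiff_substitute (γ : V →L[ℝ] V →L[ℝ] ℝ) {r : ℕ → V → V →L[ℝ] V →L[ℝ] ℝ}
    (hr : ∀ l, ContDiff ℝ ∞ (r l)) (P : Free) : ContDiff ℝ ∞ (substitute γ r P) := by
  induction P using FreeAlgebra.induction with
  | grade0 c =>
    rw [substitute, AlgHom.commutes]
    exact contDiff_const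
  | grade1 n =>
    rw [substitute, FreeAlgebra.lift_ι_apply]
    exact contDiff_const.clm_comp (hr _)
  | mul a b ha hb =>
    rw [substitute, map_mul]
    exact ha.clm_comp hb
  | add a b ha hb =>
    rw [substitute, map_add]
    exact ha.add hb

theorem contDiff_taylorPoly (γ : V →L[ℝ] V →L[ℝ] ℝ) {r : ℕ → V → V →L[ℝ] V →L[ℝ] ℝ}
    (hr : ∀ l, ContDiff ℝ ∞ (r l)) (N : ℕ) : ContDiff ℝ ∞ (taylorPoly γ r N) :=
  ContDiff.sum fun n _ =>
    (contDiff_const.clm_comp (contDiff_substitute γ hr (Q n))).const_smul (1 / (n.factorial : ℝ))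

variable [FiniteDimensional ℝ V]

theorem IsPseudoEuclidean.apply_toEnd {γ : V →L[ℝ] V →L[ℝ] ℝ} (hγ : IsPseudoEuclidean γ)
    (b : V →L[ℝ] V →L[ℝ] ℝ) (x : V) : γ (toEnd γ b x) = b x :=
  hγ.isInvertible.self_apply_inverse _

theorem IsPseudoEuclidean.toEnd_injective {γ : V →L[ℝ] V →L[ℝ] ℝ} (hγ : IsPseudoEuclidean γ) :
    Function.Injective (toEnd γ) := by
  intro b b' h
  ext x y
  rw [← hγ.apply_toEnd, h, hγ.apply_toEnd]

/-- The truncated expansion attached to normal tensors is a metric in normal coordinates, and the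
tensors are its symmetrized curvature jet. -/
theorem taylorPoly_isNormal {γ : V →L[ℝ] V →L[ℝ] ℝ} (hγ : IsPseudoEuclidean γ)
    {h : (l : ℕ) → V [×(l + 2)]→L[ℝ] (V →L[ℝ] V →L[ℝ] ℝ)}
    (hh : ∀ l, h l ∈ normalTensors V (l + 2)) (k : ℕ) {P : V → V →L[ℝ] V →L[ℝ] ℝ}
    (hP : P = taylorPoly γ (fun l ξ => h l fun _ => ξ) (k + 2)) :
    (∃ ε > 0, IsNormalMetricOn P (Metric.ball 0 ε) ∧ P 0 = γ) ∧
      ∀ l ≤ k, ∀ ξ : V, symCurvature P l ξ = h l fun _ => ξ := by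
  have : CompleteSpace V := FiniteDimensional.complete ℝ V
  set x : V → ℕ → V →L[ℝ] V := fun ξ l => toEnd γ (h l fun _ => ξ) with hx
  have hPx : ∀ ξ y z, P ξ y z = ∑ n ∈ Finset.range (k + 2 + 1),
      (1 / (n.factorial : ℝ)) * γ (evalAt (x ξ) (Q n) y) z := fun ξ y z => by
    rw [hP, taylorPoly_apply]
  have hself : ∀ ξ j y z, γ (x ξ j y) z = γ y (x ξ j z) := fun ξ j y z => by
    rw [hγ.symm y, hγ.apply_toEnd, hγ.apply_toEnd]
    exact (hh j).2.1 _ y z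
  have hker : ∀ ξ j, x ξ j ξ = 0 := fun ξ j => by
    refine hγ.isInvertible.injective ?_
    rw [hγ.apply_toEnd, map_zero]
    ext y
    exact (hh j).2.2 ξ y
  have hscale : ∀ (t : ℝ) ξ, x (t • ξ) = fun j => t ^ (j + 2) • x ξ j := fun t ξ => by
    funext j
    have := (h j).map_smul_univ (fun _ => t) (fun _ => ξ)
    simp only [Finset.prod_const, Finset.card_univ, Fintype.card_fin] at this
    simp only [hx, toEnd, this, ContinuousLinearMap.comp_smul]
  have hsymm : ∀ ξ y z, P ξ y z = P ξ z y := fun ξ y z => by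
    simp only [hPx]
    refine Finset.sum_congr rfl fun n _ => ?_
    rw [form_evalAt_Q_symm hγ.symm (hself ξ)]
  -- Only the term n = 0 survives on v. Used with v = ξ for the Gauss condition, and at ξ = 0, where
  -- all substituted operators vanish.
  have hfix : ∀ ξ v, (∀ j, x ξ j v = 0) → ∀ w, P ξ v w = γ v w := by
    intro ξ v hv w
    rw [hPx, Finset.sum_range_succ', Finset.sum_eq_zero, evalAt_Q_zero]
    · simp
    · intro n _
      rw [form_evalAt_Q_succ_eq_zero (hself ξ) hv, mul_zero]
  have hP0 : P 0 = γ := by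
    ext v w
    refine hfix 0 v (fun j => ?_) w
    have := congrFun (hscale 0 0) j
    rw [zero_smul ℝ (0 : V), zero_pow (by omega), zero_smul] at this
    rw [this, _root_.zero_apply]
  have hsmooth : ContDiff ℝ ∞ P := by
    rw [hP]
    exact contDiff_taylorPoly γ (fun l => (h l).contDiff.comp (by fun_prop)) _
  obtain ⟨e, he⟩ := hγ.isInvertible
  have hinv : ∀ᶠ ξ in 𝓝 (0 : V), (P ξ).IsInvertible := by
    have h1 := e.nhds
    rw [he, ← hP0] at h1
    exact hsmooth.continuous.continuousAt.eventually h1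
  obtain ⟨ε, hε, hball⟩ := Metric.eventually_nhds_iff_ball.1 hinv
  have hmetric : IsPseudoRiemannianOn P (Metric.ball 0 ε) :=
    ⟨Metric.isOpen_ball, hsmooth.contDiffOn,
      fun ξ hξ => isPseudoEuclidean_of_isInvertible (hball ξ hξ) (hsymm ξ)⟩
  have hΓ : ∀ ξ, christoffel P ξ ξ ξ = 0 := fun ξ =>
    christoffel_self_of_radial (hsmooth.differentiable (by simp) ξ) hsymm hγ.symm
      fun p w => hfix p p (hker p) w
  -- Both sides represent the n-th radial derivative of P at 0: one by the normal-coordinate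
  -- formula, the other read off the polynomial in t.
  have hQ : ∀ ξ, ∀ n < k + 3, evalAt (fun l => toEnd γ (symCurvature P l ξ)) (Q n) =
      evalAt (x ξ) (Q n) := by
    intro ξ n hn
    ext y
    refine hγ.isInvertible.injective ?_
    ext z
    have h1 := hmetric.iterate_deriv_ray_metric (Metric.mem_ball_self hε) (fun p _ => hΓ p) ξ n y z
    rw [hP0] at h1
    rw [← h1]
    have h2 : (fun t : ℝ => P (t • ξ) y z) = fun t => ∑ i ∈ Finset.range (k + 3),
        t ^ i * ((1 / (i.factorial : ℝ)) * γ (evalAt (x ξ) (Q i) y) z) := by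
      funext t
      rw [hPx]
      refine Finset.sum_congr rfl fun i _ => ?_
      rw [hscale, evalAt_Q_scale, _root_.smul_apply, map_smul, _root_.smul_apply, smul_eq_mul]
      ring
    rw [h2, iterate_deriv_polynomial_zero _ hn]
    have : (n.factorial : ℝ) ≠ 0 := by positivity
    field_simp
  refine ⟨⟨ε, hε, isNormalMetricOn_ball hε hmetric fun ξ _ => hΓ ξ, hP0⟩, fun l => ?_⟩
  induction l using Nat.strong_induction_on with
  | _ l ih =>
    intro hl ξ
    refine hγ.toEnd_injective (eq_of_evalAt_Q_eq
      (x := fun l => toEnd γ (symCurvature P l ξ)) (x' := x ξ) (fun j hj => ?_)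
      (hQ ξ (l + 2) (by omega)))
    exact congrArg (toEnd γ) (ih j hj (by omega) ξ)

end Prescribed

end NormalJet

end

theorem propositionp {V : Type*} [NormedAddCommGroup V] [NormedSpace ℝ V]
    [FiniteDimensional ℝ V] (γ : V →L[ℝ] V →L[ℝ] ℝ) (hγ : NormalJet.IsPseudoEuclidean γ) :
    (∀ (g : V → V →L[ℝ] V →L[ℝ] ℝ) (U : Set V),
      NormalJet.IsNormalMetricOn g U → g 0 = γ →
        ∀ N : ℕ,
          (fun ξ => g ξ - NormalJet.taylorPoly γ (NormalJet.symCurvature g) N ξ)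
            =O[𝓝 (0 : V)] fun ξ => ‖ξ‖ ^ (N + 1)) ∧
    (∀ (k : ℕ) (h : (l : ℕ) → V [×(l + 2)]→L[ℝ] (V →L[ℝ] V →L[ℝ] ℝ)),
      (∀ l ≤ k, h l ∈ NormalJet.normalTensors V (l + 2)) →
        ∀ P : V → V →L[ℝ] V →L[ℝ] ℝ,
          P = NormalJet.taylorPoly γ (fun l ξ => h l fun _ => ξ) (k + 2) →
            (∃ ε > 0, NormalJet.IsNormalMetricOn P (Metric.ball 0 ε) ∧ P 0 = γ) ∧
              ∀ l ≤ k, ∀ ξ : V, NormalJet.symCurvature P l ξ = h l fun _ => ξ) := by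
  refine ⟨fun g U hg h0 N => h0 ▸ hg.isBigO_taylorPoly N, fun k h hh P hP => ?_⟩
  -- Extension by zero is harmless: Q_n with n ≤ k + 2 involves only the tensors of index at most k.
  have hh' : ∀ l, (if l ≤ k then h l else 0) ∈ NormalJet.normalTensors V (l + 2) := fun l => by
    split_ifs with hl
    · exact hh l hl
    · exact Submodule.zero_mem _
  obtain ⟨h1, h2⟩ := NormalJet.taylorPoly_isNormal hγ (h := fun l => if l ≤ k then h l else 0)
    hh' k (P := P) (hP.trans (NormalJet.taylorPoly_congr γ fun l hl => by
      funext ξ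
      rw [if_pos (by omega)]))
  refine ⟨h1, fun l hl ξ => ?_⟩
  rw [h2 l hl ξ, if_pos hl]
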